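/- Let $f\colon B\to M$ be a smooth map between (finite-dimensional, Hausdorff, second countable) smooth manifolds without boundary. A Dirac structure on $M$ is a smooth subbundle $L\subset TM\oplus T^*M$ whose fibres are maximal isotropic for the pairing $\langle (X,\xi),(X',\xi')\rangle=\xi'(X)+\xi(X')$ and whose smooth sections are closed under the Courant bracket $$[(X,\xi),(X',\xi')]=([X,X'],\,\mathcal L_X\xi'-\iota_{X'}\mathrm d\xi).$$ Let $L$ be a Dirac structure on $M$. Write $f^!L:=f^*L\times_{TM}TB$ for the family of vector spaces over $B$ with fibres $$(f^!L)_x=\{(\ell,X)\in L_{f(x)}\times T_xB:\ \mathrm{pr}_{TM}(\ell)=f_*X\},$$ and say that $f^!L$ is smooth if the dimension of $(f^!L)_x$ does not depend on $x\in B$. Put $$\mathfrak BL:=\{(X,f^*\eta):\ X\in T_xB,\ \eta\in T^*_{f(x)}M,\ (f_*X,\eta)\in L_{f(x)},\ x\in B\}\subset TB\oplus T^*B.$$ The singular foliation of a Dirac structure $L$ is $\mathcal F_L:=\mathrm{pr}_{TM}(\Gamma_c(L))$, the set of vector fields obtained by projecting the compactly supported smooth sections of $L$. For a set $\mathcal F$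 of vector fields on $M$, the pullback $f^{-1}\mathcal F$ is the set of compactly supported smooth vector fields $X$ on $B$ such that $f_*X=\sum_i h_i\,(Y_i\circ f)$ for finitely many $h_i\in C^\infty_c(B)$ and $Y_i\in\mathcal F$. If $f^!L$ is smooth, then $\mathfrak BL$ is a Dirac structure on $B$, and $$\mathcal F_{\mathfrak BL}=f^{-1}(\mathcal F_L).$$ -/

import Mathlib

open scoped Manifold ContDiff Topology Bundle

noncomputable section

namespace DiracPullback

section OneManifold

variable {E : Type*} [NormedAddCommGroup E] [NormedSpace ℝ E]
  {H : Type*} [TopologicalSpace H] (I : ModelWithCorners ℝ E H)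
  {M : Type*} [TopologicalSpace M] [ChartedSpace H M]

/-- The cotangent space `T*_p M`. -/
abbrev Cotangent (p : M) : Type _ := TangentSpace I p →L[ℝ] ℝ

/-- The fibre `T_p M ⊕ T*_p M` of the generalized tangent bundle. -/
abbrev GenTangent (p : M) : Type _ := TangentSpace I p × Cotangent I p

/-- A (not necessarily smooth) section of `TM ⊕ T*M`. -/
abbrev GenSection (M : Type*) [TopologicalSpace M] [ChartedSpace H M] : Type _ :=
  ∀ p : M, GenTangent I p

/-- A (not necessarily smooth) vector field on `M`. -/
abbrev VecField (M : Type*) [TopologicalSpace M] [ChartedSpace H M] : Type _ :=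
  ∀ p : M, TangentSpace I p

/-- A linear subspace of `T_p M ⊕ T*_p M` for every point `p`. -/
abbrev GenDistribution (M : Type*) [TopologicalSpace M] [ChartedSpace H M] : Type _ :=
  ∀ p : M, Submodule ℝ (GenTangent I p)

/-- The vector field `X` is smooth on the set `U`. -/
def SmoothVecFieldOn [IsManifold I ∞ M] (X : VecField I M) (U : Set M) : Prop :=
  ContMDiffOn I (I.prod 𝓘(ℝ, E)) ∞ (fun p => (⟨p, X p⟩ : TangentBundle I M)) U

/-- The one-form `ξ` is smooth on the set `U`, as a section of the bundle `Hom(TM, ℝ)`. -/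
def SmoothFormOn [IsManifold I ∞ M] (ξ : ∀ p : M, Cotangent I p) (U : Set M) : Prop :=
  ContMDiffOn I (I.prod 𝓘(ℝ, E →L[ℝ] ℝ)) ∞
    (fun p => Bundle.TotalSpace.mk' (E →L[ℝ] ℝ)
      (E := fun q : M => TangentSpace I q →L[ℝ] Bundle.Trivial M ℝ q) p (ξ p)) U

/-- The section `s = (X, ξ)` of `TM ⊕ T*M` is smooth on the set `U`. -/
def SmoothGenSectionOn [IsManifold I ∞ M] (s : GenSection I M) (U : Set M) : Prop :=
  SmoothVecFieldOn I (fun p => (s p).1) U ∧ SmoothFormOn I (fun p => (s p).2) U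

/-- `L` is a smooth subbundle of `TM ⊕ T*M`: it has a constant rank `k`, and near every point
it has a frame of `k` smooth sections. -/
def IsSmoothSubbundle [IsManifold I ∞ M] (L : GenDistribution I M) : Prop :=
  ∃ k : ℕ, ∀ p : M, ∃ U : Set M, IsOpen U ∧ p ∈ U ∧ ∃ s : Fin k → GenSection I M,
    (∀ i, SmoothGenSectionOn I (s i) U) ∧
    ∀ q ∈ U, LinearIndependent ℝ (fun i => s i q) ∧
      Submodule.span ℝ (Set.range fun i => s i q) = L q

/-- The canonical symmetric pairing `⟨(v, α), (w, β)⟩ = β(v) + α(w)` on `T_p M ⊕ T*_p M`. -/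
def pairing (p : M) (u v : GenTangent I p) : ℝ := v.2 u.1 + u.2 v.1

/-- The subspace `W` of `T_p M ⊕ T*_p M` is isotropic. -/
def IsIsotropic (p : M) (W : Submodule ℝ (GenTangent I p)) : Prop :=
  ∀ u ∈ W, ∀ v ∈ W, pairing I p u v = 0

/-- The one-form `ξ` read in the preferred chart `φ` at `p`, that is `(φ⁻¹)^* ξ`. -/
def formInChart (p : M) (ξ : ∀ q : M, Cotangent I q) (y : E) : E →L[ℝ] ℝ :=
  (ξ ((extChartAt I p).symm y)).comp
    (mfderivWithin 𝓘(ℝ, E) I (extChartAt I p).symm (Set.range I) y)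

/-- The exterior derivative of the one-form `ξ` at `p`, as the map `v ↦ ι_v dξ = dξ(v, ·)`.
It is computed in the preferred chart `φ` at `p` by
`dη(v, w) = (D_v η)(w) - (D_w η)(v)` for `η = (φ⁻¹)^* ξ`, and pulled back along `φ`. -/
def extDerivForm (ξ : ∀ q : M, Cotangent I q) (p : M) (v : TangentSpace I p) : Cotangent I p :=
  let D : E →L[ℝ] E →L[ℝ] ℝ :=
    fderivWithin ℝ (formInChart I p ξ) (Set.range I) (extChartAt I p p)
  let A : TangentSpace I p →L[ℝ] E := mfderiv I 𝓘(ℝ, E) (extChartAt I p) p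
  (D (A v) - D.flip (A v)).comp A

/-- The differential of a function at `p`. -/
def differential (g : M → ℝ) (p : M) : Cotangent I p := mfderiv I 𝓘(ℝ, ℝ) g p

/-- The Lie derivative of a one-form along a vector field, `L_X ξ = ι_X dξ + d(ι_X ξ)`. -/
def lieDerivForm (X : VecField I M) (ξ : ∀ q : M, Cotangent I q) (p : M) : Cotangent I p :=
  extDerivForm I ξ p (X p) + differential I (fun q => ξ q (X q)) p

/-- The Courant bracket (in the non-skew-symmetric convention)
`[(X, ξ), (X', ξ')] = ([X, X'], L_X ξ' - ι_{X'} dξ)`. -/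
def courantBracket (s t : GenSection I M) : GenSection I M := fun p =>
  (VectorField.mlieBracket I (fun q => (s q).1) (fun q => (t q).1) p,
    lieDerivForm I (fun q => (s q).1) (fun q => (t q).2) p
      - extDerivForm I (fun q => (s q).2) p (t p).1)

/-- `s` is a smooth global section of `L`, i.e. `s ∈ Γ(L)`. -/
def IsSectionOf [IsManifold I ∞ M] (L : GenDistribution I M) (s : GenSection I M) : Prop :=
  SmoothGenSectionOn I s Set.univ ∧ ∀ p, s p ∈ L p

/-- `L` is a Dirac structure on `M`: a smooth subbundle of `TM ⊕ T*M`, whose fibres are maximal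
isotropic for the canonical pairing, and which is involutive for the Courant bracket. -/
structure IsDirac [IsManifold I ∞ M] (L : GenDistribution I M) : Prop where
  smooth_subbundle : IsSmoothSubbundle I L
  maximal_isotropic : ∀ p, Maximal (IsIsotropic I p) (L p)
  involutive : ∀ s t : GenSection I M, IsSectionOf I L s → IsSectionOf I L t →
    ∀ p, courantBracket I s t p ∈ L p

/-- The set `F_L = pr_{TM}(Γ_c(L))` of vector fields: the projections to `TM` of the compactly
supported smooth sections of `L`. For a Dirac structure `L` this is its singular foliation. -/
def foliation [IsManifold I ∞ M] (L : GenDistribution I M) : Set (VecField I M) :=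
  {X | ∃ s : GenSection I M, IsSectionOf I L s ∧ IsCompact (closure {p | s p ≠ 0}) ∧
    ∀ p, X p = (s p).1}

end OneManifold

section Pullback

variable {E : Type*} [NormedAddCommGroup E] [NormedSpace ℝ E]
  {H : Type*} [TopologicalSpace H] (I : ModelWithCorners ℝ E H)
  {B : Type*} [TopologicalSpace B] [ChartedSpace H B]
  {E' : Type*} [NormedAddCommGroup E'] [NormedSpace ℝ E']
  {H' : Type*} [TopologicalSpace H'] (J : ModelWithCorners ℝ E' H')
  {M : Type*} [TopologicalSpace M] [ChartedSpace H' M]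

/-- The fibre at `x` of `f^! L = f^*L ×_{TM} TB`: the pairs `(ℓ, X)` with `ℓ ∈ L_{f(x)}`,
`X ∈ T_x B` and `pr_{TM} ℓ = f_* X`. -/
def shriekFibre (f : B → M) (L : GenDistribution J M) (x : B) :
    Submodule ℝ (GenTangent J (f x) × TangentSpace I x) where
  carrier := {z | z.1 ∈ L (f x) ∧ z.1.1 = mfderiv I J f x z.2}
  add_mem' {a b} ha hb := ⟨(L (f x)).add_mem ha.1 hb.1, by simp [ha.2, hb.2]⟩
  zero_mem' := ⟨(L (f x)).zero_mem, by simp⟩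
  smul_mem' c a ha := ⟨(L (f x)).smul_mem c ha.1, by simp [ha.2]⟩

/-- `f^! L` is smooth: its fibres have constant rank. -/
def ShriekSmooth (f : B → M) (L : GenDistribution J M) : Prop :=
  ∃ k : ℕ, ∀ x : B, Module.finrank ℝ (shriekFibre I J f L x) = k

/-- The backward image `𝔅L = {(X, f^*η) : (f_* X, η) ∈ L}`. -/
def backward (f : B → M) (L : GenDistribution J M) : GenDistribution I B := fun x =>
  { carrier := {u | ∃ η : Cotangent J (f x),
      (mfderiv I J f x u.1, η) ∈ L (f x) ∧ u.2 = η.comp (mfderiv I J f x)}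
    add_mem' := by
      rintro a b ⟨η, h, e⟩ ⟨θ, h', e'⟩
      refine ⟨η + θ, ?_, ?_⟩
      · simpa using (L (f x)).add_mem h h'
      · simp [e, e']
    zero_mem' := by
      refine ⟨0, ?_, ?_⟩
      · rw [show (0 : GenTangent I x).1 = 0 from rfl, map_zero]
        exact (L (f x)).zero_mem
      · simp
    smul_mem' := by
      rintro c a ⟨η, h, e⟩
      refine ⟨c • η, ?_, ?_⟩
      · simpa using (L (f x)).smul_mem c h
      · simp [e] }

/-- The pullback `f⁻¹ F` of a set `F` of vector fields on `M`: the compactly supported smooth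
vector fields `X` on `B` for which `f_* X` is a finite sum `∑ h_i (Y_i ∘ f)` with compactly
supported smooth functions `h_i` on `B` and `Y_i ∈ F`. -/
def pullbackFoliation [IsManifold I ∞ B] (f : B → M) (F : Set (VecField J M)) :
    Set (VecField I B) :=
  {X | SmoothVecFieldOn I X Set.univ ∧ IsCompact (closure {x | X x ≠ 0}) ∧
    ∃ (n : ℕ) (h : Fin n → B → ℝ) (Y : Fin n → VecField J M),
      (∀ i, ContMDiff I 𝓘(ℝ, ℝ) ∞ (h i) ∧ HasCompactSupport (h i) ∧ Y i ∈ F) ∧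
      ∀ x, mfderiv I J f x (X x) = ∑ i, h i x • Y i (f x)}

end Pullback

end DiracPullback

end

/-!
The theorem is local on `B`, and it comes down to lifting sections of the backward image `𝔅L` to
`f^! L`.

*Linear algebra.* A maximal isotropic subspace `W` of `V ⊕ V*` equals its own orthogonal, because
it contains the annihilator of its projection to `V` (`isLagrangian_of_maximal`). Being its own
orthogonal passes to backward images along linear maps (`IsLagrangian.backward`) and forces
`dim W = dim V`. So `𝔅L` always has maximal isotropic fibres of dimension `dim B`; only its
smoothness is at stake.

*Local lifts.* Let `e_i = (Y_i, θ_i)` be a frame of `L` near `f x₀`. The fibre of `f^! L` at `x` is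
the kernel of `(c, v) ↦ ∑ c_i Y_i(f x) - f_* v`. When the dimension of this kernel is constant,
every vector in the kernel at `x₀` extends to a smooth family of vectors in the kernels at nearby points
(`exists_smooth_kernel_extension`). The map `(c, v) ↦ (v, ∑ c_i f^* θ_i)` carries `f^! L` onto `𝔅L`,
whose rank is constant, so lifts of a basis of `𝔅L` at `x₀` yield a smooth frame of `𝔅L` together
with a smooth right inverse of `f^! L → 𝔅L`. Hence smooth sections of `𝔅L` are locally of the form
`(X, ∑ a_i f^* θ_i)` with `f_* X = ∑ a_i (Y_i ∘ f)` and `a_i` smooth (`exists_local_lift`).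

*Involutivity.* If `s` and `t` are sections of `𝔅L` with lifts of coefficients `a_i` and `b_j`, then
`[s, t]` is the backward image of
`∑ a_i b_j [e_i, e_j] + ∑ (X b_j) e_j - ∑ (X' a_i) e_i`,
where `X` and `X'` are the vector field parts of `s` and `t`; the terms `⟨e_i, e_j⟩ b_j da_i` that
could spoil this vanish because `L` is isotropic. The identity is proved between vector spaces
(`fderiv_lieBracket_pushforward`, `flatBracketForm_pullback`) and transported through the charts
in which the bracket is defined (`courantBracket_mem_backward`).

*The foliation.* A compactly supported section of `𝔅L` is cut by a partition of unity into finitely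
many pieces that lift, which expresses `f_* X` as a finite sum `∑ h_i (Y_i ∘ f)`. Conversely, if
`f_* X = ∑ h_i (Y_i ∘ f)` with `(Y_i, θ_i)` compactly supported sections of `L`, then
`(X, ∑ h_i f^* θ_i)` is a compactly supported section of `𝔅L`.
-/

open scoped Manifold ContDiff Topology Bundle

noncomputable section

namespace DiracPullback

/-! ### Isotropic subspaces of `V ⊕ V*` -/

section Lagrangian

variable {V : Type*} [AddCommGroup V] [Module ℝ V] [TopologicalSpace V] [IsTopologicalAddGroup V]
  [ContinuousSMul ℝ V] [T2Space V] [FiniteDimensional ℝ V]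
  {V' : Type*} [AddCommGroup V'] [Module ℝ V'] [TopologicalSpace V'] [IsTopologicalAddGroup V']
  [ContinuousSMul ℝ V'] [T2Space V'] [FiniteDimensional ℝ V']

/-- The canonical pairing on `V ⊕ V*`, as a bilinear form. -/
def pairForm (V : Type*) [AddCommGroup V] [Module ℝ V] [TopologicalSpace V]
    [IsTopologicalAddGroup V] [ContinuousSMul ℝ V] :
    LinearMap.BilinForm ℝ (V × (V →L[ℝ] ℝ)) :=
  LinearMap.mk₂ ℝ (fun u v => v.2 u.1 + u.2 v.1)
    (fun u u' v => by simp; ring) (fun c u v => by simp; ring)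
    (fun u v v' => by simp; ring) (fun c u v => by simp; ring)

omit [T2Space V] [FiniteDimensional ℝ V] in
@[simp] lemma pairForm_apply (u v : V × (V →L[ℝ] ℝ)) :
    pairForm V u v = v.2 u.1 + u.2 v.1 := rfl

/-- A subspace of `V ⊕ V*` that is its own orthogonal for the canonical pairing. -/
def IsLagrangian (W : Submodule ℝ (V × (V →L[ℝ] ℝ))) : Prop :=
  ∀ u, u ∈ W ↔ ∀ w ∈ W, pairForm V u w = 0

omit [T2Space V] [FiniteDimensional ℝ V] in
lemma pairForm_comm (u v : V × (V →L[ℝ] ℝ)) : pairForm V u v = pairForm V v u := by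
  simp [add_comm]

omit [T2Space V] [FiniteDimensional ℝ V] in
lemma IsLagrangian.maximal {W : Submodule ℝ (V × (V →L[ℝ] ℝ))} (hW : IsLagrangian W) :
    Maximal (fun N : Submodule ℝ (V × (V →L[ℝ] ℝ)) => ∀ u ∈ N, ∀ v ∈ N, pairForm V u v = 0) W :=
  ⟨fun u hu => (hW u).1 hu, fun _ hN hWN u hu => (hW u).2 fun w hw => hN u hu w (hWN hw)⟩

omit [T2Space V] [FiniteDimensional ℝ V] in
/-- A vector orthogonal to a maximal isotropic subspace and to itself belongs to the subspace. -/
lemma mem_of_maximal_isotropic {W : Submodule ℝ (V × (V →L[ℝ] ℝ))}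
    (hW : Maximal (fun N : Submodule ℝ (V × (V →L[ℝ] ℝ)) =>
      ∀ u ∈ N, ∀ v ∈ N, pairForm V u v = 0) W) {u : V × (V →L[ℝ] ℝ)}
    (hu : ∀ w ∈ W, pairForm V u w = 0) (huu : pairForm V u u = 0) : u ∈ W := by
  refine hW.2 (y := W ⊔ Submodule.span ℝ {u}) ?_ le_sup_left
    (Submodule.mem_sup_right (Submodule.mem_span_singleton_self u))
  intro a ha b hb
  obtain ⟨w, hw, y, hy, rfl⟩ := Submodule.mem_sup.1 ha
  obtain ⟨c, rfl⟩ := Submodule.mem_span_singleton.1 hy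
  obtain ⟨w', hw', y', hy', rfl⟩ := Submodule.mem_sup.1 hb
  obtain ⟨c', rfl⟩ := Submodule.mem_span_singleton.1 hy'
  have h1 := hW.1 w hw w' hw'
  have h2 := hu w' hw'
  have h3 := pairForm_comm w u ▸ hu w hw
  simp only [map_add, LinearMap.add_apply, map_smul, LinearMap.smul_apply, h1, h2, h3, huu]
  simp

lemma mem_of_forall_annihilator {D : Submodule ℝ V} {v : V}
    (h : ∀ ξ : V →L[ℝ] ℝ, (∀ d ∈ D, ξ d = 0) → ξ v = 0) : v ∈ D := by
  by_contra hv
  obtain ⟨φ, hφ, hφD⟩ := Submodule.exists_le_ker_of_notMem hv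
  exact hφ (h (LinearMap.toContinuousLinearMap φ) fun d hd => hφD hd)

/-- Maximal isotropic subspaces are Lagrangian: if `(v, ζ)` is orthogonal to `W` then `v` lies in
the projection of `W` to `V`, because `W` contains the annihilator of that projection. -/
lemma isLagrangian_of_maximal {W : Submodule ℝ (V × (V →L[ℝ] ℝ))}
    (hW : Maximal (fun N : Submodule ℝ (V × (V →L[ℝ] ℝ)) =>
      ∀ u ∈ N, ∀ v ∈ N, pairForm V u v = 0) W) : IsLagrangian W := by
  have hann : ∀ ξ : V →L[ℝ] ℝ, (∀ w ∈ W, ξ w.1 = 0) → ((0 : V), ξ) ∈ W := fun ξ hξ =>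
    mem_of_maximal_isotropic hW (fun w hw => by simpa using hξ w hw) (by simp)
  refine fun u => ⟨hW.1 u, fun hu => ?_⟩
  have hD : u.1 ∈ W.map (LinearMap.fst ℝ V (V →L[ℝ] ℝ)) := by
    refine mem_of_forall_annihilator fun ξ hξ => ?_
    simpa using hu _ (hann ξ fun w hw => hξ _ (Submodule.mem_map_of_mem hw))
  obtain ⟨w, hw, hwu⟩ := hD
  have key : ((0 : V), u.2 - w.2) ∈ W := by
    refine hann _ fun w' hw' => ?_
    have h1 := hu w' hw'
    have h2 := hW.1 w hw w' hw'
    simp only [pairForm_apply, LinearMap.fst_apply] at h1 h2 hwu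
    rw [← hwu] at h1
    simp only [sub_apply]
    linarith
  have : u = w + (0, u.2 - w.2) := by
    ext1
    · simpa using hwu.symm
    · simp
  rw [this]
  exact W.add_mem hw key

omit [T2Space V] [FiniteDimensional ℝ V] in
/-- The backward image of a Lagrangian subspace along a linear map is Lagrangian. -/
lemma IsLagrangian.backward {W : Submodule ℝ (V' × (V' →L[ℝ] ℝ))} (hW : IsLagrangian W)
    (F : V →L[ℝ] V') {N : Submodule ℝ (V × (V →L[ℝ] ℝ))}
    (hN : ∀ u, u ∈ N ↔ ∃ η : V' →L[ℝ] ℝ, (F u.1, η) ∈ W ∧ u.2 = η.comp F) :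
    IsLagrangian N := by
  refine fun u => ⟨fun hu w hw => ?_, fun hu => ?_⟩
  · obtain ⟨η, h, e⟩ := (hN u).1 hu
    obtain ⟨θ, h', e'⟩ := (hN w).1 hw
    simpa [e, e'] using (hW _).1 h _ h'
  set D := W.map (LinearMap.fst ℝ V' (V' →L[ℝ] ℝ)) with hDdef
  have hann : ∀ ξ : V' →L[ℝ] ℝ, (∀ d ∈ D, ξ d = 0) → ((0 : V'), ξ) ∈ W := fun ξ hξ =>
    (hW _).2 fun w hw => by simpa using hξ _ (Submodule.mem_map_of_mem hw)
  have hD : F u.1 ∈ D := by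
    refine mem_of_forall_annihilator fun ξ hξ => ?_
    have : ((0 : V), ξ.comp F) ∈ N := (hN _).2 ⟨ξ, by simpa using hann ξ hξ, rfl⟩
    simpa using hu _ this
  obtain ⟨⟨w, α⟩, hα, rfl : w = F u.1⟩ := hD
  -- after subtracting `(u.1, F^* α)`, a functional vanishing on `F⁻¹ D` remains
  have hker : ((u.2 - α.comp F : V →L[ℝ] ℝ) : V →ₗ[ℝ] ℝ) ∈
      (LinearMap.ker (D.mkQ ∘ₗ (F : V →ₗ[ℝ] V'))).dualAnnihilator := by
    rw [Submodule.mem_dualAnnihilator]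
    intro y hy
    have hy' : F y ∈ D := by simpa using hy
    obtain ⟨⟨w', β⟩, hβ, rfl : w' = F y⟩ := hy'
    have h1 := hu (y, β.comp F) ((hN _).2 ⟨β, hβ, rfl⟩)
    have h2 := (hW _).1 hα _ hβ
    simp only [pairForm_apply, ContinuousLinearMap.comp_apply] at h1 h2
    simp only [ContinuousLinearMap.coe_coe, sub_apply,
      ContinuousLinearMap.comp_apply]
    linarith
  rw [← LinearMap.range_dualMap_eq_dualAnnihilator_ker] at hker
  obtain ⟨φ, hφ⟩ := hker
  refine (hN u).2 ⟨α + LinearMap.toContinuousLinearMap (φ ∘ₗ D.mkQ), ?_, ?_⟩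
  · have := W.add_mem hα (hann (LinearMap.toContinuousLinearMap (φ ∘ₗ D.mkQ)) fun d hd => by
      simp [(Submodule.Quotient.mk_eq_zero D).2 hd])
    simpa using this
  · ext y
    have := LinearMap.congr_fun hφ y
    simp only [LinearMap.dualMap_apply, LinearMap.comp_apply, ContinuousLinearMap.coe_coe,
      sub_apply, ContinuousLinearMap.comp_apply] at this
    simp only [ContinuousLinearMap.comp_apply, add_apply,
      LinearMap.coe_toContinuousLinearMap', LinearMap.comp_apply]
    linarith

lemma finrank_dual_eq : Module.finrank ℝ (V →L[ℝ] ℝ) = Module.finrank ℝ V :=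
  (LinearMap.toContinuousLinearMap (𝕜 := ℝ) (E := V) (F' := ℝ)).finrank_eq.symm.trans
    Subspace.dual_finrank_eq

lemma IsLagrangian.finrank_eq {W : Submodule ℝ (V × (V →L[ℝ] ℝ))} (hW : IsLagrangian W) :
    Module.finrank ℝ W = Module.finrank ℝ V := by
  have : FiniteDimensional ℝ (V →L[ℝ] ℝ) :=
    (LinearMap.toContinuousLinearMap (𝕜 := ℝ) (E := V) (F' := ℝ)).finiteDimensional
  have hB : (pairForm V).Nondegenerate := by
    have hsep : (pairForm V).SeparatingLeft := by
      intro u hu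
      have h2 : u.2 = 0 := by
        ext y; simpa using hu (y, 0)
      have h1 : u.1 = 0 := by
        have : u.1 ∈ (⊥ : Submodule ℝ V) :=
          mem_of_forall_annihilator fun ξ _ => by simpa using hu (0, ξ)
        simpa using this
      exact Prod.ext h1 h2
    exact ⟨hsep, fun u hu => hsep u fun y => by rw [pairForm_comm]; exact hu y⟩
  have horth : (pairForm V).orthogonal W = W := by
    ext u
    rw [LinearMap.BilinForm.mem_orthogonal_iff, hW u]
    exact forall₂_congr fun w _ => by rw [pairForm_comm]
  have h := LinearMap.BilinForm.finrank_orthogonal hB W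
  have hle := W.finrank_le
  rw [horth, Module.finrank_prod, finrank_dual_eq] at h
  rw [Module.finrank_prod, finrank_dual_eq] at hle
  omega

lemma IsLagrangian.nonempty_basis {W : Submodule ℝ (V × (V →L[ℝ] ℝ))} (hW : IsLagrangian W) :
    Nonempty (Module.Basis (Fin (Module.finrank ℝ V)) ℝ W) :=
  have : FiniteDimensional ℝ (V →L[ℝ] ℝ) :=
    (LinearMap.toContinuousLinearMap (𝕜 := ℝ) (E := V) (F' := ℝ)).finiteDimensional
  have : Module.Free ℝ W := Module.Free.of_divisionRing ℝ W
  ⟨Module.finBasisOfFinrankEq ℝ W hW.finrank_eq⟩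

end Lagrangian

/-! ### Kernels of constant rank -/

section ConstantRank

variable {B : Type*} [TopologicalSpace B]
  {E : Type*} [NormedAddCommGroup E] [NormedSpace ℝ E]
  {H : Type*} [TopologicalSpace H] {I : ModelWithCorners ℝ E H} [ChartedSpace H B]
  {V : Type*} [NormedAddCommGroup V] [NormedSpace ℝ V] [FiniteDimensional ℝ V]
  {W : Type*} [NormedAddCommGroup W] [NormedSpace ℝ W] [FiniteDimensional ℝ W]

omit [FiniteDimensional ℝ V] in
lemma exists_generalized_inverse (Φ : V →L[ℝ] W) :
    ∃ A : W →L[ℝ] V, ∀ v, Φ (A (Φ v)) = Φ v := by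
  obtain ⟨g, hg⟩ := (Φ : V →ₗ[ℝ] W).rangeRestrict.exists_rightInverse_of_surjective
    (LinearMap.range_rangeRestrict _)
  obtain ⟨A, hA⟩ := LinearMap.exists_extend g
  refine ⟨LinearMap.toContinuousLinearMap A, fun v => ?_⟩
  have h1 : A (Φ v) = g ((Φ : V →ₗ[ℝ] W).rangeRestrict v) :=
    LinearMap.congr_fun hA ((Φ : V →ₗ[ℝ] W).rangeRestrict v)
  have h2 := congrArg Subtype.val (LinearMap.congr_fun hg ((Φ : V →ₗ[ℝ] W).rangeRestrict v))
  simpa [h1] using h2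

lemma contMDiffAt_ringInverse {x : B} {G : B → V →L[ℝ] V}
    (hG : ContMDiffAt I 𝓘(ℝ, V →L[ℝ] V) ∞ G x) (hx : IsUnit (G x)) :
    ContMDiffAt I 𝓘(ℝ, V →L[ℝ] V) ∞ (fun y => Ring.inverse (G y)) x := by
  have : CompleteSpace V := FiniteDimensional.complete ℝ V
  obtain ⟨u, hu⟩ := hx
  have h := contDiffAt_ringInverse ℝ (n := ∞) u
  rw [hu] at h
  exact h.contMDiffAt.comp x hG

omit [FiniteDimensional ℝ V] in
lemma contMDiffAt_clm_comp_const {V₁ V₂ : Type*} [NormedAddCommGroup V₁] [NormedSpace ℝ V₁]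
    [NormedAddCommGroup V₂] [NormedSpace ℝ V₂] {x : B} {n : WithTop ℕ∞} {G : B → V →L[ℝ] V₁}
    (hG : ContMDiffAt I 𝓘(ℝ, V →L[ℝ] V₁) n G x) (A : V₁ →L[ℝ] V₂) :
    ContMDiffAt I 𝓘(ℝ, V →L[ℝ] V₂) n (fun y => A ∘L G y) x :=
  (contMDiffAt_const (c := A)).clm_comp hG

/-- A smooth family of linear maps whose kernels have constant dimension near `x₀` has kernels that
form a smooth bundle near `x₀`: there are smooth operators `P x`, with values in `ker (Φ x)`, such
that `P x₀` is the identity on `ker (Φ x₀)`. -/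
lemma exists_smooth_kernel_extension {x₀ : B} {Φ : B → V →L[ℝ] W}
    (hΦ : ∀ᶠ x in 𝓝 x₀, ContMDiffAt I 𝓘(ℝ, V →L[ℝ] W) ∞ Φ x)
    (hrank : ∀ᶠ x in 𝓝 x₀, Module.finrank ℝ (LinearMap.ker (Φ x : V →ₗ[ℝ] W)) =
      Module.finrank ℝ (LinearMap.ker (Φ x₀ : V →ₗ[ℝ] W))) :
    ∃ P : B → V →L[ℝ] V, (∀ᶠ x in 𝓝 x₀, ContMDiffAt I 𝓘(ℝ, V →L[ℝ] V) ∞ P x) ∧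
      (∀ᶠ x in 𝓝 x₀, ∀ v, Φ x (P x v) = 0) ∧ ∀ v, Φ x₀ v = 0 → P x₀ v = v := by
  have : CompleteSpace V := FiniteDimensional.complete ℝ V
  obtain ⟨A, hA⟩ := exists_generalized_inverse (Φ x₀)
  -- `Q` is the projection to `ker (Φ x₀)`, and `G x` carries `ker (Φ x)` to `ker (Φ x₀)`
  set Q : V →L[ℝ] V := 1 - A ∘L Φ x₀ with hQ
  set G : B → V →L[ℝ] V := fun x => Q + A ∘L Φ x with hG
  have hGsm : ∀ᶠ x in 𝓝 x₀, ContMDiffAt I 𝓘(ℝ, V →L[ℝ] V) ∞ G x := by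
    filter_upwards [hΦ] with x hx
    exact contMDiffAt_const.add (contMDiffAt_clm_comp_const hx A)
  have hG0 : G x₀ = 1 := by simp [hG, hQ]
  have hunit : ∀ᶠ x in 𝓝 x₀, IsUnit (G x) := by
    have hc : ContinuousAt G x₀ := hGsm.self_of_nhds.continuousAt
    refine hc.eventually (Units.isOpen.mem_nhds ?_)
    rw [hG0]
    exact isUnit_one
  have hQ0 : ∀ v, Φ x₀ (Q v) = 0 := fun v => by simp [hQ, hA]
  have hQv : ∀ v, Φ x₀ v = 0 → Q v = v := fun v hv => by simp [hQ, hv]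
  refine ⟨fun x => Ring.inverse (G x) ∘L Q, ?_, ?_, ?_⟩
  · filter_upwards [hGsm, hunit] with x hx hu
    exact (contMDiffAt_ringInverse hx hu).clm_comp contMDiffAt_const
  · filter_upwards [hunit, hrank] with x hu hr v
    have hinv : ∀ w, Ring.inverse (G x) (G x w) = w := fun w => by
      have := Ring.inverse_mul_cancel (G x) hu
      exact DFunLike.congr_fun this w
    have hinj : Function.Injective (G x) := fun a b hab => by
      rw [← hinv a, ← hinv b, hab]
    have hmap : (LinearMap.ker (Φ x : V →ₗ[ℝ] W)).map (G x : V →ₗ[ℝ] V) ≤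
        LinearMap.ker (Φ x₀ : V →ₗ[ℝ] W) := by
      rintro _ ⟨w, hw, rfl⟩
      have hw' : Φ x w = 0 := hw
      have : G x w = Q w := by simp [hG, hw']
      simpa [this] using hQ0 w
    have heq := Submodule.eq_of_le_of_finrank_eq hmap (by
      rw [← hr]
      exact (Submodule.equivMapOfInjective (G x : V →ₗ[ℝ] V) hinj _).finrank_eq.symm)
    have hmem : Q v ∈ (LinearMap.ker (Φ x : V →ₗ[ℝ] W)).map (G x : V →ₗ[ℝ] V) := by
      rw [heq]; exact hQ0 v
    obtain ⟨w, hw, hwv⟩ := hmem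
    have hwv' : G x w = Q v := hwv
    simp only [ContinuousLinearMap.comp_apply, ← hwv', hinv]
    exact hw
  · intro v hv
    simp [hG0, hQv v hv]

/-- If `F x` is a smooth family of linear maps with `F x₀` injective, then `F x` has a smooth left
inverse near `x₀`. -/
lemma exists_smooth_leftInverse {x₀ : B} {F : B → V →L[ℝ] W}
    (hF : ∀ᶠ x in 𝓝 x₀, ContMDiffAt I 𝓘(ℝ, V →L[ℝ] W) ∞ F x)
    (hinj : Function.Injective (F x₀)) :
    ∃ C : B → W →L[ℝ] V, (∀ᶠ x in 𝓝 x₀, ContMDiffAt I 𝓘(ℝ, W →L[ℝ] V) ∞ C x) ∧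
      ∀ᶠ x in 𝓝 x₀, ∀ v, C x (F x v) = v := by
  have : CompleteSpace V := FiniteDimensional.complete ℝ V
  obtain ⟨A, hA⟩ := exists_generalized_inverse (F x₀)
  have hGsm : ∀ᶠ x in 𝓝 x₀, ContMDiffAt I 𝓘(ℝ, V →L[ℝ] V) ∞ (fun x => A ∘L F x) x := by
    filter_upwards [hF] with x hx
    exact contMDiffAt_clm_comp_const hx A
  have hG0 : A ∘L F x₀ = 1 := by
    ext v; exact hinj (hA v)
  have hunit : ∀ᶠ x in 𝓝 x₀, IsUnit (A ∘L F x) := by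
    refine hGsm.self_of_nhds.continuousAt.eventually (Units.isOpen.mem_nhds ?_)
    change IsUnit (A ∘L F x₀)
    rw [hG0]
    exact isUnit_one
  refine ⟨fun x => Ring.inverse (A ∘L F x) ∘L A, ?_, ?_⟩
  · filter_upwards [hGsm, hunit] with x hx hu
    exact (contMDiffAt_ringInverse hx hu).clm_comp contMDiffAt_const
  · filter_upwards [hunit] with x hu v
    exact DFunLike.congr_fun (Ring.inverse_mul_cancel (A ∘L F x) hu) v

end ConstantRank

/-! ### The Courant bracket of sections along a map between vector spaces -/

section Flat

variable {E : Type*} [NormedAddCommGroup E] [NormedSpace ℝ E]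
  {E' : Type*} [NormedAddCommGroup E'] [NormedSpace ℝ E']

/-- The form component `L_X ξ' - ι_{X'} dξ` of the Courant bracket of `(X, ξ)` and `(X', ξ')` on a
vector space. -/
def flatBracketForm (X X' : E → E) (ξ ξ' : E → E →L[ℝ] ℝ) (y : E) : E →L[ℝ] ℝ :=
  (fderiv ℝ ξ' y (X y) - (fderiv ℝ ξ' y).flip (X y)) + fderiv ℝ (fun z => ξ' z (X z)) y
    - (fderiv ℝ ξ y (X' y) - (fderiv ℝ ξ y).flip (X' y))

lemma flatBracketForm_apply {X X' : E → E} {ξ ξ' : E → E →L[ℝ] ℝ} {y : E}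
    (hX : DifferentiableAt ℝ X y) (hξ' : DifferentiableAt ℝ ξ' y) (v : E) :
    flatBracketForm X X' ξ ξ' y v = fderiv ℝ ξ' y (X y) v + ξ' y (fderiv ℝ X y v)
      - fderiv ℝ ξ y (X' y) v + fderiv ℝ ξ y v (X' y) := by
  have h := (hξ'.hasFDerivAt.clm_apply hX.hasFDerivAt).fderiv
  simp only [flatBracketForm, h, sub_apply, add_apply,
    ContinuousLinearMap.flip_apply, ContinuousLinearMap.comp_apply]
  ring

variable {ι : Type*} [Fintype ι] {g : E → E'} {y : E}
  {X X' : E → E} {a b : ι → E → ℝ} {Y : ι → E' → E'}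
  {ξ ξ' : E → E →L[ℝ] ℝ} {θ : ι → E' → E' →L[ℝ] ℝ}

/-- Differentiating `g_* X = ∑ a_i (Y_i ∘ g)`. -/
lemma fderiv_pushforward (hg : ContDiffAt ℝ 2 g y) (hX : DifferentiableAt ℝ X y)
    (ha : ∀ i, DifferentiableAt ℝ (a i) y) (hY : ∀ i, DifferentiableAt ℝ (Y i) (g y))
    (h : ∀ᶠ z in 𝓝 y, fderiv ℝ g z (X z) = ∑ i, a i z • Y i (g z)) (u : E) :
    fderiv ℝ g y (fderiv ℝ X y u) = ∑ i, fderiv ℝ (a i) y u • Y i (g y)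
      + ∑ i, a i y • fderiv ℝ (Y i) (g y) (fderiv ℝ g y u)
      - fderiv ℝ (fderiv ℝ g) y u (X y) := by
  have hgd : DifferentiableAt ℝ g y := hg.differentiableAt (by norm_num)
  have hg' : DifferentiableAt ℝ (fderiv ℝ g) y :=
    (hg.fderiv_right (m := 1) (by norm_num)).differentiableAt (by norm_num)
  have h1 := hg'.hasFDerivAt.clm_apply hX.hasFDerivAt
  have h2 : HasFDerivAt (fun z => ∑ i, a i z • Y i (g z)) _ y := HasFDerivAt.fun_sum fun i _ =>
    (ha i).hasFDerivAt.smul ((hY i).hasFDerivAt.comp y hgd.hasFDerivAt)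
  have h3 := DFunLike.congr_fun (h1.unique (h2.congr_of_eventuallyEq h)) u
  simp only [add_apply, ContinuousLinearMap.comp_apply,
    ContinuousLinearMap.flip_apply, sum_apply,
    smul_apply, ContinuousLinearMap.smulRight_apply,
    Finset.sum_add_distrib] at h3
  rw [eq_sub_iff_add_eq, h3, add_comm]

/-- Differentiating `ξ = ∑ a_i g^* θ_i`. -/
lemma fderiv_pullback_form (hg : ContDiffAt ℝ 2 g y)
    (ha : ∀ i, DifferentiableAt ℝ (a i) y) (hθ : ∀ i, DifferentiableAt ℝ (θ i) (g y))
    (h : ∀ᶠ z in 𝓝 y, ξ z = ∑ i, a i z • (θ i (g z)).comp (fderiv ℝ g z)) :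
    DifferentiableAt ℝ ξ y ∧ ∀ u v, fderiv ℝ ξ y u v =
      ∑ i, fderiv ℝ (a i) y u * θ i (g y) (fderiv ℝ g y v)
      + ∑ i, a i y * fderiv ℝ (θ i) (g y) (fderiv ℝ g y u) (fderiv ℝ g y v)
      + ∑ i, a i y * θ i (g y) (fderiv ℝ (fderiv ℝ g) y u v) := by
  have hgd : DifferentiableAt ℝ g y := hg.differentiableAt (by norm_num)
  have hg' : DifferentiableAt ℝ (fderiv ℝ g) y :=
    (hg.fderiv_right (m := 1) (by norm_num)).differentiableAt (by norm_num)
  have h2 : HasFDerivAt (fun z => ∑ i, a i z • (θ i (g z)).comp (fderiv ℝ g z)) _ y :=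
    HasFDerivAt.fun_sum fun i _ => (ha i).hasFDerivAt.smul
      (((hθ i).hasFDerivAt.comp y hgd.hasFDerivAt).clm_comp hg'.hasFDerivAt)
  have h3 := h2.congr_of_eventuallyEq h
  refine ⟨h3.differentiableAt, fun u v => ?_⟩
  rw [h3.fderiv]
  simp [Finset.sum_add_distrib]
  ring

lemma fderiv_lieBracket_pushforward (hg : ContDiffAt ℝ 2 g y)
    (hX : DifferentiableAt ℝ X y) (hX' : DifferentiableAt ℝ X' y)
    (ha : ∀ i, DifferentiableAt ℝ (a i) y) (hb : ∀ i, DifferentiableAt ℝ (b i) y)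
    (hY : ∀ i, DifferentiableAt ℝ (Y i) (g y))
    (h : ∀ᶠ z in 𝓝 y, fderiv ℝ g z (X z) = ∑ i, a i z • Y i (g z))
    (h' : ∀ᶠ z in 𝓝 y, fderiv ℝ g z (X' z) = ∑ i, b i z • Y i (g z)) :
    fderiv ℝ g y (VectorField.lieBracket ℝ X X' y) =
      ∑ i, ∑ j, (a i y * b j y) • VectorField.lieBracket ℝ (Y i) (Y j) (g y)
      + ∑ j, fderiv ℝ (b j) y (X y) • Y j (g y) - ∑ i, fderiv ℝ (a i) y (X' y) • Y i (g y) := by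
  have hsymm : fderiv ℝ (fderiv ℝ g) y (X y) (X' y) = fderiv ℝ (fderiv ℝ g) y (X' y) (X y) :=
    (hg.isSymmSndFDerivAt (by simp)).eq _ _
  simp only [VectorField.lieBracket, map_sub, smul_sub, Finset.sum_sub_distrib]
  rw [fderiv_pushforward hg hX' hb hY h', fderiv_pushforward hg hX ha hY h, hsymm,
    h.self_of_nhds, h'.self_of_nhds]
  have e1 : ∑ i, b i y • fderiv ℝ (Y i) (g y) (∑ i, a i y • Y i (g y)) =
      ∑ i, ∑ j, (a i y * b j y) • fderiv ℝ (Y j) (g y) (Y i (g y)) := by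
    rw [Finset.sum_comm]
    simp only [map_sum, map_smul, Finset.smul_sum, smul_smul, mul_comm]
  have e2 : ∑ i, a i y • fderiv ℝ (Y i) (g y) (∑ i, b i y • Y i (g y)) =
      ∑ i, ∑ j, (a i y * b j y) • fderiv ℝ (Y i) (g y) (Y j (g y)) := by
    simp only [map_sum, map_smul, Finset.smul_sum, smul_smul]
  rw [e1, e2]
  abel

/-- The form part of the Courant bracket of two sections of the backward image. The terms with
`d a_i` cancel because the `(Y_i, θ_i)` span an isotropic subspace. -/
lemma flatBracketForm_pullback (hg : ContDiffAt ℝ 2 g y)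
    (hX : DifferentiableAt ℝ X y)
    (ha : ∀ i, DifferentiableAt ℝ (a i) y) (hb : ∀ i, DifferentiableAt ℝ (b i) y)
    (hY : ∀ i, DifferentiableAt ℝ (Y i) (g y)) (hθ : ∀ i, DifferentiableAt ℝ (θ i) (g y))
    (h : ∀ᶠ z in 𝓝 y, fderiv ℝ g z (X z) = ∑ i, a i z • Y i (g z))
    (h' : fderiv ℝ g y (X' y) = ∑ i, b i y • Y i (g y))
    (hξ : ∀ᶠ z in 𝓝 y, ξ z = ∑ i, a i z • (θ i (g z)).comp (fderiv ℝ g z))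
    (hξ' : ∀ᶠ z in 𝓝 y, ξ' z = ∑ i, b i z • (θ i (g z)).comp (fderiv ℝ g z))
    (hiso : ∀ i j, θ i (g y) (Y j (g y)) + θ j (g y) (Y i (g y)) = 0) :
    flatBracketForm X X' ξ ξ' y =
      (∑ i, ∑ j, (a i y * b j y) • flatBracketForm (Y i) (Y j) (θ i) (θ j) (g y)
      + ∑ j, fderiv ℝ (b j) y (X y) • θ j (g y)
      - ∑ i, fderiv ℝ (a i) y (X' y) • θ i (g y)).comp (fderiv ℝ g y) := by
  have hsymm : ∀ u v, fderiv ℝ (fderiv ℝ g) y u v = fderiv ℝ (fderiv ℝ g) y v u :=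
    fun u v => (hg.isSymmSndFDerivAt (by simp)).eq _ _
  obtain ⟨-, d1⟩ := fderiv_pullback_form hg ha hθ hξ
  obtain ⟨dξ', d2⟩ := fderiv_pullback_form hg hb hθ hξ'
  ext v
  set w := fderiv ℝ g y v with hw
  rw [flatBracketForm_apply hX dξ', d1, d1, d2, hξ'.self_of_nhds]
  simp only [sum_apply, smul_apply,
    ContinuousLinearMap.comp_apply, sub_apply, add_apply, smul_eq_mul, ← hw,
    fderiv_pushforward hg hX ha hY h v, flatBracketForm_apply (hY _) (hθ _),
    h.self_of_nhds, h', map_add, map_sub, hsymm (X y) v, hsymm (X' y) v]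
  have e1 : ∑ i, b i y * fderiv ℝ (θ i) (g y) (∑ i, a i y • Y i (g y)) w =
      ∑ i, ∑ j, (a i y * b j y) * fderiv ℝ (θ j) (g y) (Y i (g y)) w := by
    rw [Finset.sum_comm]
    simp only [map_sum, map_smul, sum_apply, smul_apply,
      smul_eq_mul, Finset.mul_sum]
    exact Finset.sum_congr rfl fun i _ => Finset.sum_congr rfl fun j _ => by ring
  have e2 : ∑ i, a i y * fderiv ℝ (θ i) (g y) (∑ i, b i y • Y i (g y)) w =
      ∑ i, ∑ j, (a i y * b j y) * fderiv ℝ (θ i) (g y) (Y j (g y)) w := by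
    simp only [map_sum, map_smul, sum_apply, smul_apply,
      smul_eq_mul, Finset.mul_sum]
    exact Finset.sum_congr rfl fun i _ => Finset.sum_congr rfl fun j _ => by ring
  have e3 : ∑ i, a i y * fderiv ℝ (θ i) (g y) w (∑ i, b i y • Y i (g y)) =
      ∑ i, ∑ j, (a i y * b j y) * fderiv ℝ (θ i) (g y) w (Y j (g y)) := by
    simp only [map_sum, map_smul, smul_eq_mul, Finset.mul_sum]
    exact Finset.sum_congr rfl fun i _ => Finset.sum_congr rfl fun j _ => by ring
  have e4 : ∑ i, b i y * θ i (g y) (∑ i, a i y • fderiv ℝ (Y i) (g y) w) =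
      ∑ i, ∑ j, (a i y * b j y) * θ j (g y) (fderiv ℝ (Y i) (g y) w) := by
    rw [Finset.sum_comm]
    simp only [map_sum, map_smul, smul_eq_mul, Finset.mul_sum]
    exact Finset.sum_congr rfl fun i _ => Finset.sum_congr rfl fun j _ => by ring
  have e5 : ∑ i, b i y * θ i (g y) (∑ i, fderiv ℝ (a i) y v • Y i (g y)) +
      ∑ i, fderiv ℝ (a i) y v * θ i (g y) (∑ i, b i y • Y i (g y)) = 0 := by
    simp only [map_sum, map_smul, smul_eq_mul, Finset.mul_sum]
    rw [Finset.sum_comm, ← Finset.sum_add_distrib]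
    refine Finset.sum_eq_zero fun i _ => ?_
    rw [← Finset.sum_add_distrib]
    refine Finset.sum_eq_zero fun j _ => ?_
    linear_combination (b j y * fderiv ℝ (a i) y v) * hiso i j
  simp only [mul_add, mul_sub, Finset.sum_add_distrib, Finset.sum_sub_distrib]
  rw [e1, e2, e3, e4]
  linear_combination e5

end Flat

/-! ### Vector fields and one-forms in charts -/

section Charts

variable {E : Type*} [NormedAddCommGroup E] [NormedSpace ℝ E]
  {H : Type*} [TopologicalSpace H] (I : ModelWithCorners ℝ E H)
  {M : Type*} [TopologicalSpace M] [ChartedSpace H M] [IsManifold I ∞ M]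

/-- The identification of `T_q M` with the model space given by the preferred chart at `p`. -/
def toModel (p q : M) : TangentSpace I q →L[ℝ] E :=
  (trivializationAt E (TangentSpace I : M → Type _) p).continuousLinearMapAt ℝ q

/-- The inverse of `toModel`. -/
def fromModel (p q : M) : E →L[ℝ] TangentSpace I q :=
  (trivializationAt E (TangentSpace I : M → Type _) p).symmL ℝ q

variable {I} {p q : M}

lemma toModel_fromModel (hq : q ∈ (chartAt H p).source) (v : E) :
    toModel I p q (fromModel I p q v) = v :=
  (trivializationAt E (TangentSpace I : M → Type _) p).continuousLinearMapAt_symmL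
    (by simpa using hq) v

lemma fromModel_toModel (hq : q ∈ (chartAt H p).source) (v : TangentSpace I q) :
    fromModel I p q (toModel I p q v) = v :=
  (trivializationAt E (TangentSpace I : M → Type _) p).symmL_continuousLinearMapAt
    (by simpa using hq) v

lemma contMDiffAt_vecField_iff {X : VecField I M} (hq : q ∈ (chartAt H p).source) :
    ContMDiffAt I (I.prod 𝓘(ℝ, E)) ∞ (fun r => (⟨r, X r⟩ : TangentBundle I M)) q ↔
      ContMDiffAt I 𝓘(ℝ, E) ∞ (fun r => toModel I p r (X r)) q := by
  set e := trivializationAt E (TangentSpace I : M → Type _) p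
  have hb : q ∈ e.baseSet := by simpa [e] using hq
  refine (e.contMDiffAt_section_iff hb).trans ?_
  refine Filter.EventuallyEq.contMDiffAt_iff ?_
  filter_upwards [e.open_baseSet.mem_nhds hb] with r hr
  exact (e.continuousLinearMapAt_apply_of_mem ℝ hr (X r)).symm

lemma contMDiffAt_form_iff {ξ : ∀ r : M, Cotangent I r} (hq : q ∈ (chartAt H p).source) :
    ContMDiffAt I (I.prod 𝓘(ℝ, E →L[ℝ] ℝ)) ∞
      (fun r => Bundle.TotalSpace.mk' (E →L[ℝ] ℝ)
        (E := fun q : M => TangentSpace I q →L[ℝ] Bundle.Trivial M ℝ q) r (ξ r)) q ↔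
      ContMDiffAt I 𝓘(ℝ, E →L[ℝ] ℝ) ∞ (fun r => (ξ r).comp (fromModel I p r)) q := by
  set e := trivializationAt (E →L[ℝ] ℝ)
    (fun q : M => TangentSpace I q →L[ℝ] Bundle.Trivial M ℝ q) p with he
  have hb : q ∈ e.baseSet := by
    rw [he, hom_trivializationAt_baseSet]
    simpa using hq
  refine (e.contMDiffAt_section_iff hb).trans ?_
  refine Filter.EventuallyEq.contMDiffAt_iff ?_
  filter_upwards [e.open_baseSet.mem_nhds hb] with r hr
  rw [he, hom_trivializationAt_apply]
  ext v
  simp [ContinuousLinearMap.inCoordinates, fromModel]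

lemma inverse_fromModel (hq : q ∈ (chartAt H p).source) :
    (fromModel I p q).inverse = toModel I p q :=
  ContinuousLinearMap.inverse_eq (ContinuousLinearMap.ext (fromModel_toModel hq))
    (ContinuousLinearMap.ext (toModel_fromModel hq))

lemma inverse_toModel (hq : q ∈ (chartAt H p).source) :
    (toModel I p q).inverse = fromModel I p q :=
  ContinuousLinearMap.inverse_eq (ContinuousLinearMap.ext (toModel_fromModel hq))
    (ContinuousLinearMap.ext (fromModel_toModel hq))

variable (I) in
/-- The vector field `X` read in the preferred chart at `p`. -/
def vecInChart (p : M) (X : VecField I M) (y : E) : E :=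
  toModel I p ((extChartAt I p).symm y) (X ((extChartAt I p).symm y))

variable (I) in
/-- The one-form `ξ` read in the preferred chart at `p`, through `fromModel`. -/
def covecInChart (p : M) (ξ : ∀ r : M, Cotangent I r) (y : E) : E →L[ℝ] ℝ :=
  (ξ ((extChartAt I p).symm y)).comp (fromModel I p ((extChartAt I p).symm y))

lemma toModel_eq (hq : q ∈ (chartAt H p).source) :
    toModel I p q = mfderiv I 𝓘(ℝ, E) (extChartAt I p) q :=
  TangentBundle.continuousLinearMapAt_trivializationAt hq

lemma fromModel_eq (hq : q ∈ (chartAt H p).source) :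
    fromModel I p q =
      mfderivWithin 𝓘(ℝ, E) I (extChartAt I p).symm (Set.range I) (extChartAt I p q) :=
  TangentBundle.symmL_trivializationAt hq

omit [IsManifold I ∞ M] in
lemma symm_mem_source {y : E} (hy : y ∈ (extChartAt I p).target) :
    (extChartAt I p).symm y ∈ (chartAt H p).source := by
  simpa using (extChartAt I p).map_target hy

lemma formInChart_eq {ξ : ∀ r : M, Cotangent I r} {y : E} (hy : y ∈ (extChartAt I p).target) :
    formInChart I p ξ y = covecInChart I p ξ y := by
  rw [covecInChart, fromModel_eq (symm_mem_source hy), formInChart, (extChartAt I p).right_inv hy]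

lemma mpullbackWithin_eq_vecInChart {X : VecField I M} {y : E}
    (hy : y ∈ (extChartAt I p).target) :
    VectorField.mpullbackWithin 𝓘(ℝ, E) I (extChartAt I p).symm X (Set.range I) y =
      vecInChart I p X y := by
  have hs := symm_mem_source hy
  have h := fromModel_eq (I := I) hs
  rw [(extChartAt I p).right_inv hy] at h
  rw [VectorField.mpullbackWithin_apply, ← h, vecInChart]
  exact DFunLike.congr_fun (inverse_fromModel (E := E) (I := I) hs) _

variable [I.Boundaryless]

lemma contMDiffAt_symm {y : E} (hy : y ∈ (extChartAt I p).target) :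
    ContMDiffAt 𝓘(ℝ, E) I ∞ (extChartAt I p).symm y :=
  (contMDiffOn_extChartAt_symm p).contMDiffAt ((isOpen_extChartAt_target p).mem_nhds hy)

lemma contDiffAt_vecInChart {X : VecField I M} {y : E} (hy : y ∈ (extChartAt I p).target)
    (hX : ContMDiffAt I (I.prod 𝓘(ℝ, E)) ∞ (fun r => (⟨r, X r⟩ : TangentBundle I M))
      ((extChartAt I p).symm y)) : ContDiffAt ℝ ∞ (vecInChart I p X) y := by
  rw [← contMDiffAt_iff_contDiffAt]
  exact ((contMDiffAt_vecField_iff (symm_mem_source hy)).1 hX).comp y (contMDiffAt_symm hy)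

lemma contDiffAt_covecInChart {ξ : ∀ r : M, Cotangent I r} {y : E}
    (hy : y ∈ (extChartAt I p).target)
    (hξ : ContMDiffAt I (I.prod 𝓘(ℝ, E →L[ℝ] ℝ)) ∞
      (fun r => Bundle.TotalSpace.mk' (E →L[ℝ] ℝ)
        (E := fun q : M => TangentSpace I q →L[ℝ] Bundle.Trivial M ℝ q) r (ξ r))
      ((extChartAt I p).symm y)) : ContDiffAt ℝ ∞ (covecInChart I p ξ) y := by
  rw [← contMDiffAt_iff_contDiffAt]
  exact ((contMDiffAt_form_iff (symm_mem_source hy)).1 hξ).comp y (contMDiffAt_symm hy)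

lemma extDerivForm_eq (ξ : ∀ r : M, Cotangent I r) (v : TangentSpace I p) :
    extDerivForm I ξ p v =
      (fderiv ℝ (covecInChart I p ξ) (extChartAt I p p) (toModel I p p v) -
        (fderiv ℝ (covecInChart I p ξ) (extChartAt I p p)).flip (toModel I p p v)).comp
          (toModel I p p) := by
  have h : formInChart I p ξ =ᶠ[𝓝 (extChartAt I p p)] covecInChart I p ξ := by
    filter_upwards [extChartAt_target_mem_nhds p] with y hy using formInChart_eq hy
  rw [extDerivForm, I.range_eq_univ, fderivWithin_univ, h.fderiv_eq,
    ← toModel_eq (mem_chart_source H p)]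

omit [I.Boundaryless] in
lemma differential_pairing_eq {X : VecField I M} {ξ : ∀ r : M, Cotangent I r}
    (hd : DifferentiableAt ℝ (fun y => covecInChart I p ξ y (vecInChart I p X y))
      (extChartAt I p p)) :
    differential I (fun q => ξ q (X q)) p =
      (fderiv ℝ (fun y => covecInChart I p ξ y (vecInChart I p X y)) (extChartAt I p p)).comp
        (toModel I p p) := by
  have h : (fun q => ξ q (X q)) =ᶠ[𝓝 p]
      (fun y => covecInChart I p ξ y (vecInChart I p X y)) ∘ extChartAt I p := by
    filter_upwards [(chartAt H p).open_source.mem_nhds (mem_chart_source H p)] with r hr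
    have hr' : (extChartAt I p).symm (extChartAt I p r) = r :=
      (extChartAt I p).left_inv (by simpa using hr)
    simp only [Function.comp_apply, covecInChart, vecInChart]
    rw [hr', ContinuousLinearMap.comp_apply, fromModel_toModel hr]
  rw [differential, h.mfderiv_eq, mfderiv_comp p (I' := 𝓘(ℝ, E)) hd.mdifferentiableAt
    (mdifferentiableAt_extChartAt (mem_chart_source H p)), mfderiv_eq_fderiv,
    ← toModel_eq (mem_chart_source H p)]
  rfl

/-- The vector component of the Courant bracket at `p`, read in the chart at `p`. -/
lemma toModel_courantBracket_fst (s t : GenSection I M) :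
    toModel I p p (courantBracket I s t p).1 =
      VectorField.lieBracket ℝ (vecInChart I p fun q => (s q).1) (vecInChart I p fun q => (t q).1)
        (extChartAt I p p) := by
  have hev : ∀ X : VecField I M,
      VectorField.mpullbackWithin 𝓘(ℝ, E) I (extChartAt I p).symm X (Set.range I)
        =ᶠ[𝓝 (extChartAt I p p)] vecInChart I p X := fun X => by
    filter_upwards [extChartAt_target_mem_nhds p] with y hy using mpullbackWithin_eq_vecInChart hy
  have hs := mem_chart_source H p
  have hL := Filter.EventuallyEq.lieBracket_vectorField_eq (𝕜 := ℝ) (E := E)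
    (hev fun q => (s q).1) (hev fun q => (t q).1)
  have hinv : (mfderiv I 𝓘(ℝ, E) (extChartAt I p) p : TangentSpace I p →L[ℝ] E).inverse =
      fromModel I p p := by
    rw [← inverse_toModel hs, toModel_eq hs]
    rfl
  have h1 := VectorField.mlieBracketWithin_apply (I := I)
    (V := fun q => (s q).1) (W := fun q => (t q).1) (s := Set.univ) (x₀ := p)
  rw [Set.preimage_univ, Set.univ_inter, I.range_eq_univ] at h1
  rw [I.range_eq_univ] at hL
  have h2 : (courantBracket I s t p).1 = fromModel I p p
      (VectorField.lieBracket ℝ (vecInChart I p fun q => (s q).1)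
        (vecInChart I p fun q => (t q).1) (extChartAt I p p)) :=
    h1.trans ((DFunLike.congr_fun hinv _).trans (congrArg _
      ((congrFun (VectorField.lieBracketWithin_univ (𝕜 := ℝ) (E := E)) _).trans hL)))
  rw [h2, toModel_fromModel hs]

/-- The form component of the Courant bracket at `p`, read in the chart at `p`. -/
lemma courantBracket_snd_comp {s t : GenSection I M}
    (hs : SmoothGenSectionOn I s Set.univ) (ht : SmoothGenSectionOn I t Set.univ) :
    ((courantBracket I s t p).2).comp (fromModel I p p) =
      flatBracketForm (vecInChart I p fun q => (s q).1) (vecInChart I p fun q => (t q).1)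
        (covecInChart I p fun q => (s q).2) (covecInChart I p fun q => (t q).2)
        (extChartAt I p p) := by
  have hp := mem_extChartAt_target (I := I) p
  have hX := (contDiffAt_vecInChart hp
    ((hs.1 _ trivial).contMDiffAt Filter.univ_mem)).differentiableAt (by simp)
  have hξ := (contDiffAt_covecInChart hp
    ((ht.2 _ trivial).contMDiffAt Filter.univ_mem)).differentiableAt (by simp)
  have hc := mem_chart_source H p
  have hv : ∀ X : VecField I M, vecInChart I p X (extChartAt I p p) = toModel I p p (X p) :=
    fun X => by rw [vecInChart, extChartAt_to_inv]
  simp only [courantBracket, lieDerivForm, extDerivForm_eq,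
    differential_pairing_eq (hξ.clm_apply hX), flatBracketForm, hv]
  ext v
  simp [toModel_fromModel hc]

end Charts

/-! ### The derivative of a smooth map in charts -/

section MapCharts

variable {E : Type*} [NormedAddCommGroup E] [NormedSpace ℝ E]
  {H : Type*} [TopologicalSpace H] {I : ModelWithCorners ℝ E H} [I.Boundaryless]
  {B : Type*} [TopologicalSpace B] [ChartedSpace H B] [IsManifold I ∞ B]
  {E' : Type*} [NormedAddCommGroup E'] [NormedSpace ℝ E']
  {H' : Type*} [TopologicalSpace H'] {J : ModelWithCorners ℝ E' H'}
  {M : Type*} [TopologicalSpace M] [ChartedSpace H' M] [IsManifold J ∞ M]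
  {f : B → M} {x₀ : B}

lemma vecInChart_extChartAt {p q : M} (hq : q ∈ (chartAt H' p).source) (X : VecField J M) :
    vecInChart J p X (extChartAt J p q) = toModel J p q (X q) := by
  rw [vecInChart, (extChartAt J p).left_inv (by simpa using hq)]

lemma covecInChart_extChartAt {p q : M} (hq : q ∈ (chartAt H' p).source)
    (ξ : ∀ r : M, Cotangent J r) :
    covecInChart J p ξ (extChartAt J p q) = (ξ q).comp (fromModel J p q) := by
  rw [covecInChart, (extChartAt J p).left_inv (by simpa using hq)]

variable (I J) in
/-- The map `f` read in the preferred charts at `x₀` and `f x₀`. -/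
def mapInChart (f : B → M) (x₀ : B) : E → E' :=
  fun y => extChartAt J (f x₀) (f ((extChartAt I x₀).symm y))

variable (I J) in
/-- The derivative of `f` at `x`, read in the preferred charts at `x₀` and `f x₀`. -/
def mfderivInChart (f : B → M) (x₀ x : B) : E →L[ℝ] E' :=
  (toModel J (f x₀) (f x)).comp ((mfderiv I J f x).comp (fromModel I x₀ x))

lemma fderiv_mapInChart (hf : ContMDiff I J ∞ f) {y : E} (hy : y ∈ (extChartAt I x₀).target)
    (hfy : f ((extChartAt I x₀).symm y) ∈ (chartAt H' (f x₀)).source) :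
    fderiv ℝ (mapInChart I J f x₀) y = mfderivInChart I J f x₀ ((extChartAt I x₀).symm y) := by
  have h1 : HasMFDerivAt 𝓘(ℝ, E) I (extChartAt I x₀).symm y
      (mfderivWithin 𝓘(ℝ, E) I (extChartAt I x₀).symm (Set.range I) y) := by
    have := (mdifferentiableWithinAt_extChartAt_symm hy).hasMFDerivWithinAt
    rw [I.range_eq_univ] at this ⊢
    exact hasMFDerivWithinAt_univ.1 this
  have h2 := (hf.mdifferentiable (by simp) ((extChartAt I x₀).symm y)).hasMFDerivAt
  have h3 := (mdifferentiableAt_extChartAt (I := J) hfy).hasMFDerivAt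
  have e1 := fromModel_eq (I := I) (symm_mem_source hy)
  rw [(extChartAt I x₀).right_inv hy] at e1
  have h4 : HasFDerivAt (mapInChart I J f x₀)
      (mfderivInChart I J f x₀ ((extChartAt I x₀).symm y)) y := by
    rw [mfderivInChart, e1, toModel_eq hfy]
    exact (hasMFDerivAt_iff_hasFDerivAt (𝕜 := ℝ) (E := E) (E' := E')).1 (h3.comp y (h2.comp y h1))
  exact h4.fderiv

lemma contDiffAt_mapInChart [J.Boundaryless] (hf : ContMDiff I J ∞ f) {y : E}
    (hy : y ∈ (extChartAt I x₀).target)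
    (hfy : f ((extChartAt I x₀).symm y) ∈ (chartAt H' (f x₀)).source) :
    ContDiffAt ℝ ∞ (mapInChart I J f x₀) y := by
  rw [← contMDiffAt_iff_contDiffAt]
  exact (contMDiffAt_extChartAt' hfy).comp y ((hf _).comp y (contMDiffAt_symm hy))

omit [I.Boundaryless] [IsManifold I ∞ B] [IsManifold J ∞ M] in
lemma eventually_mem_charts (hf : ContMDiff I J ∞ f) (x₀ : B) :
    ∀ᶠ x in 𝓝 x₀, x ∈ (chartAt H x₀).source ∧ f x ∈ (chartAt H' (f x₀)).source := by
  filter_upwards [(chartAt H x₀).open_source.mem_nhds (mem_chart_source H x₀),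
    hf.continuous.continuousAt.eventually
      ((chartAt H' (f x₀)).open_source.mem_nhds (mem_chart_source H' (f x₀)))] with x h1 h2
    using ⟨h1, h2⟩

lemma contMDiffAt_mfderivInChart [J.Boundaryless] (hf : ContMDiff I J ∞ f) (x₀ : B) :
    ∀ᶠ x in 𝓝 x₀, ContMDiffAt I 𝓘(ℝ, E →L[ℝ] E') ∞ (mfderivInChart I J f x₀) x := by
  filter_upwards [(eventually_mem_charts hf x₀).eventually_nhds] with x hx
  have hxs := hx.self_of_nhds.1
  have hinv : ∀ r ∈ (chartAt H x₀).source, (extChartAt I x₀).symm (extChartAt I x₀ r) = r :=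
    fun r hr => (extChartAt I x₀).left_inv (by simpa using hr)
  have hmem : ∀ r ∈ (chartAt H x₀).source, extChartAt I x₀ r ∈ (extChartAt I x₀).target :=
    fun r hr => (extChartAt I x₀).map_source (by simpa using hr)
  have hg := contDiffAt_mapInChart (x₀ := x₀) hf (hmem x hxs)
    (by rw [hinv x hxs]; exact hx.self_of_nhds.2)
  have hg' : ContDiffAt ℝ ∞ (fderiv ℝ (mapInChart I J f x₀)) (extChartAt I x₀ x) :=
    hg.fderiv_right (by simp)
  refine (hg'.contMDiffAt.comp x (contMDiffAt_extChartAt' hxs)).congr_of_eventuallyEq ?_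
  filter_upwards [hx] with r hr
  rw [Function.comp_apply, fderiv_mapInChart hf (hmem r hr.1) (by rw [hinv r hr.1]; exact hr.2),
    hinv r hr.1]

end MapCharts

/-! ### Compactly supported local frames -/

section Frames

variable {E : Type*} [NormedAddCommGroup E] [NormedSpace ℝ E] [FiniteDimensional ℝ E]
  {H : Type*} [TopologicalSpace H] {I : ModelWithCorners ℝ E H}
  {M : Type*} [TopologicalSpace M] [ChartedSpace H M] [IsManifold I ∞ M] [T2Space M]

omit [FiniteDimensional ℝ E] [T2Space M] in
lemma SmoothGenSectionOn.contMDiffAt_fst {s : GenSection I M} {U : Set M} {p : M}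
    (hs : SmoothGenSectionOn I s U) (hU : U ∈ 𝓝 p) :
    ContMDiffAt I (I.prod 𝓘(ℝ, E)) ∞ (fun q => (⟨q, (s q).1⟩ : TangentBundle I M)) p :=
  (hs.1 p (mem_of_mem_nhds hU)).contMDiffAt hU

omit [FiniteDimensional ℝ E] [T2Space M] in
lemma SmoothGenSectionOn.contMDiffAt_snd {s : GenSection I M} {U : Set M} {p : M}
    (hs : SmoothGenSectionOn I s U) (hU : U ∈ 𝓝 p) :
    ContMDiffAt I (I.prod 𝓘(ℝ, E →L[ℝ] ℝ)) ∞
      (fun r => Bundle.TotalSpace.mk' (E →L[ℝ] ℝ)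
        (E := fun q : M => TangentSpace I q →L[ℝ] Bundle.Trivial M ℝ q) r (s r).2) p :=
  (hs.2 p (mem_of_mem_nhds hU)).contMDiffAt hU

/-- Near every point a smooth subbundle is framed by compactly supported global sections. -/
lemma exists_compactly_supported_frame {L : GenDistribution I M} (hL : IsSmoothSubbundle I L)
    (p : M) : ∃ (k : ℕ) (e : Fin k → GenSection I M),
      (∀ i, IsSectionOf I L (e i) ∧ IsCompact (closure {q | e i q ≠ 0})) ∧
      ∀ᶠ q in 𝓝 p, LinearIndependent ℝ (fun i => e i q) ∧
        Submodule.span ℝ (Set.range fun i => e i q) = L q := by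
  obtain ⟨k, hk⟩ := hL
  obtain ⟨U, hU, hpU, s, hs, hsL⟩ := hk p
  obtain ⟨ρ, hρ, -⟩ := (SmoothBumpFunction.nhds_basis_support (I := I) (hU.mem_nhds hpU)).mem_iff.1
    (Filter.univ_mem : Set.univ ∈ 𝓝 p)
  refine ⟨k, fun i q => ρ q • s i q, fun i => ⟨⟨⟨?_, ?_⟩, fun q => ?_⟩, ?_⟩, ?_⟩
  · rw [SmoothVecFieldOn, contMDiffOn_univ]
    exact ContMDiffOn.smul_section_of_tsupport ρ.contMDiff.contMDiffOn hU hρ (hs i).1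
  · rw [SmoothFormOn, contMDiffOn_univ]
    exact ContMDiffOn.smul_section_of_tsupport ρ.contMDiff.contMDiffOn hU hρ (hs i).2
  · by_cases hq : q ∈ tsupport ρ
    · rw [← (hsL q (hρ hq)).2]
      exact Submodule.smul_mem _ _ (Submodule.subset_span ⟨i, rfl⟩)
    · simp [image_eq_zero_of_notMem_tsupport hq]
  · refine ρ.hasCompactSupport.isCompact.of_isClosed_subset isClosed_closure (closure_mono ?_)
    intro q hq h0
    exact hq (by simp [h0])
  · filter_upwards [ρ.eventuallyEq_one, hU.mem_nhds hpU] with q hq hqU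
    have : ρ q = 1 := hq
    simpa [this] using hsL q hqU

variable (I) in
/-- The identification of `T_q M ⊕ T*_q M` with `E ⊕ E*` given by the preferred chart at `p`. -/
def genToModel (p q : M) : GenTangent I q →ₗ[ℝ] E × (E →L[ℝ] ℝ) where
  toFun u := (toModel I p q u.1, u.2.comp (fromModel I p q))
  map_add' u v := by ext <;> simp
  map_smul' c u := by ext <;> simp

variable (I) in
/-- The inverse of `genToModel`. -/
def genFromModel (p q : M) : E × (E →L[ℝ] ℝ) →ₗ[ℝ] GenTangent I q where
  toFun u := (fromModel I p q u.1, u.2.comp (toModel I p q))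
  map_add' u v := by ext <;> simp
  map_smul' c u := by ext <;> simp

omit [FiniteDimensional ℝ E] [T2Space M] in
lemma genToModel_genFromModel {p q : M} (hq : q ∈ (chartAt H p).source) (u : E × (E →L[ℝ] ℝ)) :
    genToModel I p q (genFromModel I p q u) = u := by
  ext v <;> simp [genToModel, genFromModel, toModel_fromModel hq]

omit [FiniteDimensional ℝ E] [T2Space M] in
lemma genFromModel_genToModel {p q : M} (hq : q ∈ (chartAt H p).source) (u : GenTangent I q) :
    genFromModel I p q (genToModel I p q u) = u := by
  refine Prod.ext ?_ (ContinuousLinearMap.ext fun v => ?_) <;>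
    simp [genToModel, genFromModel, fromModel_toModel hq]

omit [FiniteDimensional ℝ E] [T2Space M] in
lemma contMDiffAt_genToModel {s : GenSection I M} {p q : M} (hq : q ∈ (chartAt H p).source)
    (hs : SmoothGenSectionOn I s Set.univ) :
    ContMDiffAt I 𝓘(ℝ, E × (E →L[ℝ] ℝ)) ∞ (fun r => genToModel I p r (s r)) q :=
  ((contMDiffAt_vecField_iff hq).1 (hs.contMDiffAt_fst Filter.univ_mem)).prodMk_space
    ((contMDiffAt_form_iff hq).1 (hs.contMDiffAt_snd Filter.univ_mem))

omit [FiniteDimensional ℝ E] [T2Space M] in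
lemma smoothGenSectionOn_genFromModel {p : M} {U : Set M} (hU : IsOpen U)
    (hUp : U ⊆ (chartAt H p).source) {F : M → E × (E →L[ℝ] ℝ)}
    (hF : ∀ q ∈ U, ContMDiffAt I 𝓘(ℝ, E × (E →L[ℝ] ℝ)) ∞ F q) :
    SmoothGenSectionOn I (fun q => genFromModel I p q (F q)) U := by
  refine ⟨fun q hq => ContMDiffAt.contMDiffWithinAt ?_,
    fun q hq => ContMDiffAt.contMDiffWithinAt ?_⟩
  · refine (contMDiffAt_vecField_iff (hUp hq)).2 ?_
    have h : ContMDiffAt I 𝓘(ℝ, E) ∞ (fun r => (F r).1) q :=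
      (ContinuousLinearMap.fst ℝ E (E →L[ℝ] ℝ)).contMDiff.contMDiffAt.comp q (hF q hq)
    refine h.congr_of_eventuallyEq ?_
    filter_upwards [hU.mem_nhds hq] with r hr
    exact toModel_fromModel (hUp hr) _
  · refine (contMDiffAt_form_iff (hUp hq)).2 ?_
    have h : ContMDiffAt I 𝓘(ℝ, E →L[ℝ] ℝ) ∞ (fun r => (F r).2) q :=
      (ContinuousLinearMap.snd ℝ E (E →L[ℝ] ℝ)).contMDiff.contMDiffAt.comp q (hF q hq)
    refine h.congr_of_eventuallyEq ?_
    filter_upwards [hU.mem_nhds hq] with r hr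
    ext v
    simp [genFromModel, toModel_fromModel (hUp hr)]

end Frames

/-! ### Local structure of the backward image -/

section Local

variable {E : Type*} [NormedAddCommGroup E] [NormedSpace ℝ E] [FiniteDimensional ℝ E]
  {H : Type*} [TopologicalSpace H] {I : ModelWithCorners ℝ E H}
  {B : Type*} [TopologicalSpace B] [ChartedSpace H B]
  {E' : Type*} [NormedAddCommGroup E'] [NormedSpace ℝ E'] [FiniteDimensional ℝ E']
  {H' : Type*} [TopologicalSpace H'] {J : ModelWithCorners ℝ E' H'}
  {M : Type*} [TopologicalSpace M] [ChartedSpace H' M]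
  {f : B → M} {L : GenDistribution J M}

instance (p : B) : T2Space (TangentSpace I p) := inferInstanceAs (T2Space E)

instance (p : B) : FiniteDimensional ℝ (TangentSpace I p) :=
  inferInstanceAs (FiniteDimensional ℝ E)

omit [FiniteDimensional ℝ E] in
lemma isLagrangian_backward {x : B} (hL : Maximal (IsIsotropic J (f x)) (L (f x))) :
    IsLagrangian (V := TangentSpace I x) (backward I J f L x) :=
  (isLagrangian_of_maximal (V := TangentSpace J (f x)) hL).backward (mfderiv I J f x)
    fun _ => Iff.rfl

omit [FiniteDimensional ℝ E] in
lemma maximal_isotropic_backward {x : B} (hL : Maximal (IsIsotropic J (f x)) (L (f x))) :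
    Maximal (IsIsotropic I x) (backward I J f L x) :=
  (isLagrangian_backward hL).maximal

lemma finrank_backward {x : B} (hL : Maximal (IsIsotropic J (f x)) (L (f x))) :
    Module.finrank ℝ (backward I J f L x) = Module.finrank ℝ E :=
  (isLagrangian_backward (I := I) hL).finrank_eq

variable [IsManifold I ∞ B] [IsManifold J ∞ M]

variable (I J) in
/-- For sections `e_i` of `TM ⊕ T*M`, the map `(c, v) ↦ ∑ c_i pr_{TM} e_i(f x) - f_* v`, read in
charts. If the `e_i` frame `L`, then its kernel is the fibre of `f^! L`. -/
def anchorDifference {k : ℕ} (f : B → M) (x₀ : B) (e : Fin k → GenSection J M) (x : B) :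
    ((Fin k → ℝ) × E) →L[ℝ] E' :=
  ∑ i, ((ContinuousLinearMap.proj i).comp (ContinuousLinearMap.fst ℝ (Fin k → ℝ) E)).smulRight
      (toModel J (f x₀) (f x) (e i (f x)).1)
    - (mfderivInChart I J f x₀ x).comp (ContinuousLinearMap.snd ℝ (Fin k → ℝ) E)

variable (I J) in
/-- For sections `e_i = (Y_i, θ_i)` of `TM ⊕ T*M`, the map `(c, v) ↦ (v, ∑ c_i f^* θ_i)`, read in
charts. -/
def backwardMap {k : ℕ} (f : B → M) (x₀ : B) (e : Fin k → GenSection J M) (x : B) :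
    ((Fin k → ℝ) × E) →L[ℝ] E × (E →L[ℝ] ℝ) :=
  (ContinuousLinearMap.snd ℝ (Fin k → ℝ) E).prod
    (∑ i, ((ContinuousLinearMap.proj i).comp (ContinuousLinearMap.fst ℝ (Fin k → ℝ) E)).smulRight
      (((e i (f x)).2.comp (fromModel J (f x₀) (f x))).comp (mfderivInChart I J f x₀ x)))

variable {k : ℕ} {x₀ x : B} {e : Fin k → GenSection J M}

omit [FiniteDimensional ℝ E] [FiniteDimensional ℝ E'] in
lemma anchorDifference_apply (c : Fin k → ℝ) (v : E) :
    anchorDifference I J f x₀ e x (c, v) =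
      toModel J (f x₀) (f x) (∑ i, c i • (e i (f x)).1 - mfderiv I J f x (fromModel I x₀ x v)) := by
  simp [anchorDifference, mfderivInChart, sum_apply]

omit [FiniteDimensional ℝ E] [FiniteDimensional ℝ E'] in
lemma backwardMap_apply (hx : f x ∈ (chartAt H' (f x₀)).source) (c : Fin k → ℝ) (v : E) :
    backwardMap I J f x₀ e x (c, v) =
      (v, (∑ i, c i • (e i (f x)).2.comp (mfderiv I J f x)).comp (fromModel I x₀ x)) := by
  refine Prod.ext ?_ (ContinuousLinearMap.ext fun w => ?_)
  · simp [backwardMap]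
  · simp [backwardMap, mfderivInChart, sum_apply, fromModel_toModel hx]

omit [FiniteDimensional ℝ E] [FiniteDimensional ℝ E'] in
lemma anchorDifference_eq_zero_iff (hx : f x ∈ (chartAt H' (f x₀)).source) (c : Fin k → ℝ) (v : E) :
    anchorDifference I J f x₀ e x (c, v) = 0 ↔
      ∑ i, c i • (e i (f x)).1 = mfderiv I J f x (fromModel I x₀ x v) := by
  rw [anchorDifference_apply, ← sub_eq_zero (a := ∑ i, c i • (e i (f x)).1)]
  refine ⟨fun h => ?_, fun h => by rw [h, map_zero]⟩
  rw [← fromModel_toModel hx (_ - _), h, map_zero]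

omit [FiniteDimensional ℝ E] [FiniteDimensional ℝ E'] in
/-- In a frame of `L`, the kernel of `anchorDifference` is isomorphic to the fibre of `f^! L`. -/
lemma finrank_ker_anchorDifference (hx : x ∈ (chartAt H x₀).source)
    (hfx : f x ∈ (chartAt H' (f x₀)).source)
    (hli : LinearIndependent ℝ (fun i => e i (f x)))
    (hspan : Submodule.span ℝ (Set.range fun i => e i (f x)) = L (f x)) :
    Module.finrank ℝ (LinearMap.ker
      (anchorDifference I J f x₀ e x : ((Fin k → ℝ) × E) →ₗ[ℝ] E')) =
      Module.finrank ℝ (shriekFibre I J f L x) := by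
  let T : ((Fin k → ℝ) × E) →ₗ[ℝ] GenTangent J (f x) × TangentSpace I x :=
    (Fintype.linearCombination ℝ (fun i => e i (f x))).prodMap (fromModel I x₀ x : E →ₗ[ℝ] _)
  have hTapp : ∀ c v, T (c, v) = (∑ i, c i • e i (f x), fromModel I x₀ x v) := fun c v => by
    simp [T, Fintype.linearCombination_apply]
  have hT : Function.Injective T := by
    rintro ⟨c, v⟩ ⟨c', v'⟩ h
    rw [hTapp, hTapp, Prod.mk.injEq] at h
    have h1 : c = c' := linearIndependent_iff_injective_fintypeLinearCombination.1 hli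
      (by simpa [Fintype.linearCombination_apply] using h.1)
    have h2 : v = v' := by
      rw [← toModel_fromModel (I := I) hx v, h.2, toModel_fromModel hx]
    rw [h1, h2]
  have hmap : (LinearMap.ker
      (anchorDifference I J f x₀ e x : ((Fin k → ℝ) × E) →ₗ[ℝ] E')).map T =
        shriekFibre I J f L x := by
    ext ⟨ℓ, X⟩
    constructor
    · rintro ⟨⟨c, v⟩, hcv, h⟩
      have hcv' := (anchorDifference_eq_zero_iff hfx c v).1 hcv
      rw [hTapp, Prod.mk.injEq] at h
      obtain ⟨rfl, rfl⟩ := h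
      refine ⟨?_, ?_⟩
      · change ∑ i, c i • e i (f x) ∈ L (f x)
        rw [← hspan]
        exact Submodule.sum_mem _ fun i _ =>
          Submodule.smul_mem _ _ (Submodule.subset_span ⟨i, rfl⟩)
      · simpa [Prod.fst_sum] using hcv'
    · rintro ⟨hℓ, hX⟩
      change ℓ ∈ L (f x) at hℓ
      change ℓ.1 = mfderiv I J f x X at hX
      rw [← hspan, Submodule.mem_span_range_iff_exists_fun] at hℓ
      obtain ⟨c, rfl⟩ := hℓ
      refine ⟨(c, toModel I x₀ x X), ?_, ?_⟩
      · refine (anchorDifference_eq_zero_iff hfx c _).2 ?_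
        rw [fromModel_toModel hx, ← hX]
        simp [Prod.fst_sum]
      · rw [hTapp, fromModel_toModel hx]
  rw [← hmap]
  exact (Submodule.equivMapOfInjective T hT _).finrank_eq

omit [FiniteDimensional ℝ E] [IsManifold I ∞ B] in
lemma contMDiffAt_sum_smulRight {V W : Type*} [NormedAddCommGroup V] [NormedSpace ℝ V]
    [NormedAddCommGroup W] [NormedSpace ℝ W] (c : Fin k → V →L[ℝ] ℝ) {w : Fin k → B → W}
    (hw : ∀ i, ContMDiffAt I 𝓘(ℝ, W) ∞ (w i) x) :
    ContMDiffAt I 𝓘(ℝ, V →L[ℝ] W) ∞ (fun y => ∑ i, (c i).smulRight (w i y)) x := by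
  refine ContMDiffAt.sum fun i _ => ?_
  exact (ContinuousLinearMap.smulRightL ℝ V W (c i)).contMDiff.contMDiffAt.comp x (hw i)

omit [FiniteDimensional ℝ E] [IsManifold I ∞ B] in
lemma contMDiffAt_clm_prod {V W W' : Type*} [NormedAddCommGroup V] [NormedSpace ℝ V]
    [NormedAddCommGroup W] [NormedSpace ℝ W] [NormedAddCommGroup W'] [NormedSpace ℝ W']
    {F : B → V →L[ℝ] W} {G : B → V →L[ℝ] W'} (hF : ContMDiffAt I 𝓘(ℝ, V →L[ℝ] W) ∞ F x)
    (hG : ContMDiffAt I 𝓘(ℝ, V →L[ℝ] W') ∞ G x) :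
    ContMDiffAt I 𝓘(ℝ, V →L[ℝ] W × W') ∞ (fun y => (F y).prod (G y)) x :=
  (ContinuousLinearMap.prodₗᵢ (𝕜 := ℝ) (E := V) (F := W) (G := W')
    ℝ).toContinuousLinearEquiv.contDiff.contMDiff.contMDiffAt.comp x (hF.prodMk_space hG)

variable [I.Boundaryless] [J.Boundaryless]

omit [FiniteDimensional ℝ E] [FiniteDimensional ℝ E'] in
lemma contMDiffAt_anchorDifference (hf : ContMDiff I J ∞ f)
    (he : ∀ i, SmoothGenSectionOn J (e i) Set.univ) :
    ∀ᶠ x in 𝓝 x₀, ContMDiffAt I 𝓘(ℝ, ((Fin k → ℝ) × E) →L[ℝ] E') ∞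
      (anchorDifference I J f x₀ e) x := by
  filter_upwards [eventually_mem_charts hf x₀, contMDiffAt_mfderivInChart hf x₀] with x hx hdf
  refine (contMDiffAt_sum_smulRight _ fun i => ?_).sub (hdf.clm_comp contMDiffAt_const)
  exact ((contMDiffAt_vecField_iff hx.2).1 ((he i).contMDiffAt_fst Filter.univ_mem)).comp x (hf x)

omit [FiniteDimensional ℝ E] [FiniteDimensional ℝ E'] in
lemma contMDiffAt_backwardMap (hf : ContMDiff I J ∞ f)
    (he : ∀ i, SmoothGenSectionOn J (e i) Set.univ) :
    ∀ᶠ x in 𝓝 x₀, ContMDiffAt I 𝓘(ℝ, ((Fin k → ℝ) × E) →L[ℝ] E × (E →L[ℝ] ℝ)) ∞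
      (backwardMap I J f x₀ e) x := by
  filter_upwards [eventually_mem_charts hf x₀, contMDiffAt_mfderivInChart hf x₀] with x hx hdf
  have hsum : ContMDiffAt I 𝓘(ℝ, ((Fin k → ℝ) × E) →L[ℝ] E →L[ℝ] ℝ) ∞ (fun y => ∑ i,
      ((ContinuousLinearMap.proj i).comp (ContinuousLinearMap.fst ℝ (Fin k → ℝ) E)).smulRight
        (((e i (f y)).2.comp (fromModel J (f x₀) (f y))).comp (mfderivInChart I J f x₀ y))) x := by
    refine contMDiffAt_sum_smulRight _ fun i => ContMDiffAt.clm_comp ?_ hdf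
    exact ((contMDiffAt_form_iff hx.2).1 ((he i).contMDiffAt_snd Filter.univ_mem)).comp x (hf x)
  exact contMDiffAt_clm_prod contMDiffAt_const hsum

variable [T2Space M]

/-- The local structure of the backward image near `x₀`: it has a smooth frame, and its smooth
sections lift to smooth sections of `f^! L`, that is, they are of the form `(X, ∑ a_i f^* θ_i)`
with `f_* X = ∑ a_i (Y_i ∘ f)` for smooth functions `a_i` and compactly supported smooth sections
`(Y_i, θ_i)` of `L`. -/
lemma exists_local_lift (hf : ContMDiff I J ∞ f) (hL : IsDirac J L)
    (hsmooth : ShriekSmooth I J f L) (x₀ : B) :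
    ∃ U : Set B, IsOpen U ∧ x₀ ∈ U ∧
      (∃ s : Fin (Module.finrank ℝ E) → GenSection I B, (∀ i, SmoothGenSectionOn I (s i) U) ∧
        ∀ x ∈ U, LinearIndependent ℝ (fun i => s i x) ∧
          Submodule.span ℝ (Set.range fun i => s i x) = backward I J f L x) ∧
      ∃ (k : ℕ) (e : Fin k → GenSection J M),
        (∀ i, IsSectionOf J L (e i) ∧ IsCompact (closure {q | e i q ≠ 0})) ∧
        ∀ s : GenSection I B, IsSectionOf I (backward I J f L) s →
          ∃ a : Fin k → B → ℝ, (∀ i, ∀ x ∈ U, ContMDiffAt I 𝓘(ℝ, ℝ) ∞ (a i) x) ∧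
            ∀ x ∈ U, mfderiv I J f x (s x).1 = ∑ i, a i x • (e i (f x)).1 ∧
              (s x).2 = ∑ i, a i x • (e i (f x)).2.comp (mfderiv I J f x) := by
  obtain ⟨k, e, he, hframe⟩ := exists_compactly_supported_frame hL.smooth_subbundle (f x₀)
  have hframe' := hf.continuous.continuousAt.eventually hframe
  have hes : ∀ i, SmoothGenSectionOn J (e i) Set.univ := fun i => (he i).1.1
  set Φ := anchorDifference I J f x₀ e with hΦ
  set Ψ := backwardMap I J f x₀ e with hΨ
  have hch := eventually_mem_charts hf x₀
  obtain ⟨d, hd⟩ := hsmooth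
  have hker : ∀ᶠ x in 𝓝 x₀, Module.finrank ℝ
      (LinearMap.ker (Φ x : ((Fin k → ℝ) × E) →ₗ[ℝ] E')) = d := by
    filter_upwards [hch, hframe'] with x hx hfr
    rw [finrank_ker_anchorDifference hx.1 hx.2 hfr.1 hfr.2, hd]
  obtain ⟨P, hPs, hPker, hP0⟩ := exists_smooth_kernel_extension
    (contMDiffAt_anchorDifference (x₀ := x₀) hf hes)
    (by filter_upwards [hker] with x hx; rw [hx, hker.self_of_nhds])
  -- `Ψ x` maps the kernel of `Φ x` to the fibre of the backward image
  have hmem : ∀ᶠ x in 𝓝 x₀, ∀ z, Φ x z = 0 → genFromModel I x₀ x (Ψ x z) ∈ backward I J f L x := by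
    filter_upwards [hch, hframe'] with x hx hfr
    rintro ⟨c, v⟩ hz
    have hz' := (anchorDifference_eq_zero_iff hx.2 c v).1 hz
    rw [hΨ, backwardMap_apply hx.2]
    refine ⟨∑ i, c i • (e i (f x)).2, ?_, ?_⟩
    · have : ∑ i, c i • e i (f x) ∈ L (f x) := by
        rw [← hfr.2]
        exact Submodule.sum_mem _ fun i _ =>
          Submodule.smul_mem _ _ (Submodule.subset_span ⟨i, rfl⟩)
      convert this using 1
      refine Prod.ext ?_ ?_
      · simpa [Prod.fst_sum, genFromModel] using hz'.symm
      · simp [Prod.snd_sum]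
    · ext w
      simp [genFromModel, fromModel_toModel hx.1, sum_apply]
  -- and onto it
  have hlift : ∀ u ∈ backward I J f L x₀, ∃ z, Φ x₀ z = 0 ∧ Ψ x₀ z = genToModel I x₀ x₀ u := by
    rintro ⟨X, ξ⟩ ⟨η, hη, hξ⟩
    have hη' := hη
    rw [← hframe'.self_of_nhds.2, Submodule.mem_span_range_iff_exists_fun] at hη'
    obtain ⟨c, hc⟩ := hη'
    have h1 := congrArg Prod.fst hc
    have h2 := congrArg Prod.snd hc
    simp only [Prod.fst_sum, Prod.snd_sum, Prod.smul_fst, Prod.smul_snd] at h1 h2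
    refine ⟨(c, toModel I x₀ x₀ X), ?_, ?_⟩
    · refine (anchorDifference_eq_zero_iff (mem_chart_source H' _) c _).2 ?_
      rw [h1, fromModel_toModel (mem_chart_source H _)]
    · rw [hΨ, backwardMap_apply (mem_chart_source H' _)]
      change ξ = _ at hξ
      refine Prod.ext rfl ?_
      change _ = ξ.comp _
      rw [hξ, ← h2]
      ext w
      simp [sum_apply]
  set n := Module.finrank ℝ E with hn
  obtain ⟨bs⟩ : Nonempty (Module.Basis (Fin n) ℝ (backward I J f L x₀)) :=
    IsLagrangian.nonempty_basis (V := TangentSpace I x₀)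
      (isLagrangian_backward (hL.maximal_isotropic (f x₀)))
  -- lifts `z` of a basis of the fibre at `x₀`; `P x` moves them into the kernels at nearby `x`
  choose z hz0 hzu using fun j => hlift (bs j) (bs j).2
  let K₀ : (Fin n → ℝ) →L[ℝ] (Fin k → ℝ) × E :=
    LinearMap.toContinuousLinearMap (Fintype.linearCombination ℝ z)
  have hK₀ : ∀ b, Φ x₀ (K₀ b) = 0 := fun b => by
    simp [K₀, Fintype.linearCombination_apply, hz0]
  set F : B → (Fin n → ℝ) →L[ℝ] E × (E →L[ℝ] ℝ) := fun x => Ψ x ∘L (P x ∘L K₀) with hF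
  have hFs : ∀ᶠ x in 𝓝 x₀, ContMDiffAt I 𝓘(ℝ, (Fin n → ℝ) →L[ℝ] E × (E →L[ℝ] ℝ)) ∞ F x := by
    filter_upwards [hPs, contMDiffAt_backwardMap (x₀ := x₀) hf hes] with x h1 h2
    exact h2.clm_comp (h1.clm_comp contMDiffAt_const)
  have hF0 : ∀ b, genFromModel I x₀ x₀ (F x₀ b) =
      ((∑ j, b j • bs j : backward I J f L x₀) : _) := by
    intro b
    have h1 : F x₀ b = genToModel I x₀ x₀ ((∑ j, b j • bs j : backward I J f L x₀) : _) := by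
      simp only [hF, ContinuousLinearMap.comp_apply, hP0 _ (hK₀ b)]
      simp [K₀, Fintype.linearCombination_apply, hzu]
    rw [h1, genFromModel_genToModel (mem_chart_source H x₀)]
  have hFinj : Function.Injective (F x₀) := by
    intro b b' h
    have h1 : (∑ j, b j • bs j) = ∑ j, b' j • bs j := by
      ext1
      rw [← hF0, ← hF0, h]
    exact linearIndependent_iff_injective_fintypeLinearCombination.1 bs.linearIndependent
      (by simpa [Fintype.linearCombination_apply] using h1)
  obtain ⟨C, hCs, hCF⟩ := exists_smooth_leftInverse hFs hFinj
  let T : ∀ x, (Fin n → ℝ) →ₗ[ℝ] GenTangent I x := fun x =>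
    genFromModel I x₀ x ∘ₗ (F x : (Fin n → ℝ) →ₗ[ℝ] E × (E →L[ℝ] ℝ))
  have hrange : ∀ᶠ x in 𝓝 x₀, LinearMap.ker (T x) = ⊥ ∧
      LinearMap.range (T x) = backward I J f L x := by
    filter_upwards [hCF, hmem, hPker, hch] with x hC hm hPk hx
    have hinj : Function.Injective (T x) := by
      intro b b' h
      have h' : F x b = F x b' := by
        rw [← genToModel_genFromModel (I := I) hx.1 (F x b),
          ← genToModel_genFromModel (I := I) hx.1 (F x b')]
        exact congrArg _ h
      rw [← hC b, h', hC]
    refine ⟨LinearMap.ker_eq_bot.2 hinj, Submodule.eq_of_le_of_finrank_eq ?_ ?_⟩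
    · rintro _ ⟨b, rfl⟩
      exact hm _ (hPk _)
    · rw [LinearMap.finrank_range_of_inj hinj, finrank_backward (hL.maximal_isotropic (f x))]
      simp [hn]
  obtain ⟨U, hU, hUo, hxU⟩ := eventually_nhds_iff.1
    (hFs.and (hCs.and (hCF.and (hrange.and (hPs.and (hPker.and hch))))))
  refine ⟨U, hUo, hxU, ⟨fun j x => genFromModel I x₀ x (F x (Pi.single j 1)), fun j => ?_,
    fun x hx => ?_⟩, k, e, he, fun s hs => ?_⟩
  · exact smoothGenSectionOn_genFromModel hUo (fun x hx => (hU x hx).2.2.2.2.2.2.1)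
      fun x hx => (hU x hx).1.clm_apply contMDiffAt_const
  · obtain ⟨h1, h2⟩ := (hU x hx).2.2.2.1
    constructor
    · have := (Pi.basisFun ℝ (Fin n)).linearIndependent.map' _ h1
      simpa [Function.comp_def, T] using this
    · rw [← h2, LinearMap.range_eq_map, ← (Pi.basisFun ℝ (Fin n)).span_eq, Submodule.map_span,
        ← Set.range_comp]
      simp [Function.comp_def, T]
  · -- the lift of `s` has the coefficients `P x (K₀ (C x (s x)))`
    let w : B → (Fin k → ℝ) × E := fun x => P x (K₀ (C x (genToModel I x₀ x (s x))))
    have hw : ∀ x ∈ U, ContMDiffAt I 𝓘(ℝ, (Fin k → ℝ) × E) ∞ w x := fun x hx =>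
      (hU x hx).2.2.2.2.1.clm_apply (contMDiffAt_const.clm_apply
        ((hU x hx).2.1.clm_apply
          (contMDiffAt_genToModel (hU x hx).2.2.2.2.2.2.1 hs.1)))
    refine ⟨fun i x => (w x).1 i, fun i x hx => ?_, fun x hx => ?_⟩
    · exact ((ContinuousLinearMap.proj (R := ℝ) (φ := fun _ : Fin k => ℝ) i).comp
        (ContinuousLinearMap.fst ℝ (Fin k → ℝ) E)).contMDiff.contMDiffAt.comp x (hw x hx)
    · obtain ⟨-, -, hC, ⟨-, hr⟩, -, hPk, hx1, hx2⟩ := hU x hx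
      have hsx : s x ∈ backward I J f L x := hs.2 x
      rw [← hr] at hsx
      obtain ⟨b, hb⟩ := hsx
      have hFb : F x b = genToModel I x₀ x (s x) := by
        rw [← hb]
        exact (genToModel_genFromModel hx1 (F x b)).symm
      have hwx : w x = P x (K₀ b) := by
        simp only [w, ← hFb, hC]
      have hΦw : Φ x (w x) = 0 := by rw [hwx]; exact hPk _
      have hΨw : Ψ x (w x) = genToModel I x₀ x (s x) := by rw [hwx, ← hFb]; rfl
      have h1 := (anchorDifference_eq_zero_iff hx2 (w x).1 (w x).2).1 hΦw
      have h2 := (backwardMap_apply hx2 (w x).1 (w x).2).symm.trans hΨw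
      have h3 : (w x).2 = toModel I x₀ x (s x).1 := congrArg Prod.fst h2
      have h4 := congrArg Prod.snd h2
      rw [h3, fromModel_toModel hx1] at h1
      refine ⟨h1.symm, ?_⟩
      ext v
      have h5 := DFunLike.congr_fun h4 (toModel I x₀ x v)
      simp only [genToModel, ContinuousLinearMap.comp_apply, LinearMap.coe_mk, AddHom.coe_mk,
        fromModel_toModel hx1] at h5
      exact h5.symm

end Local

section Main

variable {E : Type*} [NormedAddCommGroup E] [NormedSpace ℝ E] [FiniteDimensional ℝ E]
  {H : Type*} [TopologicalSpace H] {I : ModelWithCorners ℝ E H} [I.Boundaryless]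
  {B : Type*} [TopologicalSpace B] [ChartedSpace H B] [IsManifold I ∞ B]
  {E' : Type*} [NormedAddCommGroup E'] [NormedSpace ℝ E'] [FiniteDimensional ℝ E']
  {H' : Type*} [TopologicalSpace H'] {J : ModelWithCorners ℝ E' H'} [J.Boundaryless]
  {M : Type*} [TopologicalSpace M] [ChartedSpace H' M] [IsManifold J ∞ M]
  {f : B → M} {L : GenDistribution J M}

/-! ### Involutivity of the backward image -/

omit [FiniteDimensional ℝ E] [FiniteDimensional ℝ E'] [J.Boundaryless] in
/-- A lift of a section of the backward image to `f^! L`, read in charts. -/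
lemma eventually_lift_inChart (hf : ContMDiff I J ∞ f) {x : B} {U : Set B} (hU : IsOpen U)
    (hxU : x ∈ U) {k : ℕ} {e : Fin k → GenSection J M} {s : GenSection I B} {a : Fin k → B → ℝ}
    (ha : ∀ x ∈ U, mfderiv I J f x (s x).1 = ∑ i, a i x • (e i (f x)).1 ∧
      (s x).2 = ∑ i, a i x • (e i (f x)).2.comp (mfderiv I J f x)) :
    ∀ᶠ z in 𝓝 (extChartAt I x x),
      fderiv ℝ (mapInChart I J f x) z (vecInChart I x (fun q => (s q).1) z) =
        ∑ i, a i ((extChartAt I x).symm z) •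
          vecInChart J (f x) (fun q => (e i q).1) (mapInChart I J f x z) ∧
      covecInChart I x (fun q => (s q).2) z =
        ∑ i, a i ((extChartAt I x).symm z) •
          (covecInChart J (f x) (fun q => (e i q).2) (mapInChart I J f x z)).comp
            (fderiv ℝ (mapInChart I J f x) z) := by
  have hcont : Filter.Tendsto (extChartAt I x).symm (𝓝 (extChartAt I x x)) (𝓝 x) := by
    have := (contMDiffAt_symm (I := I) (mem_extChartAt_target x)).continuousAt
    rwa [ContinuousAt, extChartAt_to_inv] at this
  filter_upwards [extChartAt_target_mem_nhds (I := I) x, hcont.eventually (hU.mem_nhds hxU),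
    hcont.eventually (eventually_mem_charts hf x)] with z hz hzU hzc
  obtain ⟨h1, h2⟩ := ha _ hzU
  rw [fderiv_mapInChart hf hz hzc.2]
  simp only [mapInChart, vecInChart_extChartAt hzc.2, covecInChart_extChartAt hzc.2]
  simp only [mfderivInChart, vecInChart, covecInChart]
  generalize (extChartAt I x).symm z = q at *
  constructor
  · simp only [ContinuousLinearMap.comp_apply, fromModel_toModel hzc.1]
    rw [h1]
    simp only [map_sum, map_smul]
  · ext v
    rw [h2]
    simp only [ContinuousLinearMap.comp_apply, sum_apply, smul_apply, fromModel_toModel hzc.2]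

omit [FiniteDimensional ℝ E] [FiniteDimensional ℝ E'] in
/-- Involutivity at `x`, for two sections of the backward image that lift to `f^! L` near `x`. -/
lemma courantBracket_mem_backward (hf : ContMDiff I J ∞ f) (hL : IsDirac J L) {x : B} {U : Set B}
    (hU : IsOpen U) (hxU : x ∈ U) {k : ℕ} {e : Fin k → GenSection J M}
    (he : ∀ i, IsSectionOf J L (e i)) {s t : GenSection I B}
    (hs : SmoothGenSectionOn I s Set.univ) (ht : SmoothGenSectionOn I t Set.univ)
    {a b : Fin k → B → ℝ} (has : ∀ i, ∀ x ∈ U, ContMDiffAt I 𝓘(ℝ, ℝ) ∞ (a i) x)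
    (hbs : ∀ i, ∀ x ∈ U, ContMDiffAt I 𝓘(ℝ, ℝ) ∞ (b i) x)
    (ha : ∀ x ∈ U, mfderiv I J f x (s x).1 = ∑ i, a i x • (e i (f x)).1 ∧
      (s x).2 = ∑ i, a i x • (e i (f x)).2.comp (mfderiv I J f x))
    (hb : ∀ x ∈ U, mfderiv I J f x (t x).1 = ∑ i, b i x • (e i (f x)).1 ∧
      (t x).2 = ∑ i, b i x • (e i (f x)).2.comp (mfderiv I J f x)) :
    courantBracket I s t x ∈ backward I J f L x := by
  have hx := mem_chart_source H x
  have hfx := mem_chart_source H' (f x)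
  set y := extChartAt I x x with hy
  have hyx : (extChartAt I x).symm y = x := extChartAt_to_inv x
  have hyt : y ∈ (extChartAt I x).target := mem_extChartAt_target x
  have hgy : mapInChart I J f x y = extChartAt J (f x) (f x) := by rw [mapInChart, hyx]
  have hft : extChartAt J (f x) (f x) ∈ (extChartAt J (f x)).target := mem_extChartAt_target _
  have hg : ContDiffAt ℝ 2 (mapInChart I J f x) y :=
    (contDiffAt_mapInChart hf hyt (by rw [hyx]; exact hfx)).of_le
      (by exact WithTop.coe_le_coe.2 le_top)
  have hg' : fderiv ℝ (mapInChart I J f x) y = mfderivInChart I J f x x := by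
    rw [fderiv_mapInChart hf hyt (by rw [hyx]; exact hfx), hyx]
  have hcoeff : ∀ c : Fin k → B → ℝ, (∀ i, ∀ x ∈ U, ContMDiffAt I 𝓘(ℝ, ℝ) ∞ (c i) x) →
      ∀ i, DifferentiableAt ℝ (fun z => c i ((extChartAt I x).symm z)) y := fun c hc i => by
    have h : ContMDiffAt 𝓘(ℝ, E) 𝓘(ℝ, ℝ) ∞ (fun z => c i ((extChartAt I x).symm z)) y :=
      ContMDiffAt.comp (I' := I) y (by rw [hyx]; exact hc i x hxU) (contMDiffAt_symm hyt)
    exact h.contDiffAt.differentiableAt (by simp)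
  have hvec : ∀ X : VecField I B, (ContMDiffAt I (I.prod 𝓘(ℝ, E)) ∞
      (fun r => (⟨r, X r⟩ : TangentBundle I B)) x) → DifferentiableAt ℝ (vecInChart I x X) y :=
    fun X hX => (contDiffAt_vecInChart hyt (by rw [hyx]; exact hX)).differentiableAt (by simp)
  have hX := hvec _ (hs.contMDiffAt_fst Filter.univ_mem)
  have hX' := hvec _ (ht.contMDiffAt_fst Filter.univ_mem)
  have hY : ∀ i, DifferentiableAt ℝ (vecInChart J (f x) fun q => (e i q).1)
      (mapInChart I J f x y) := fun i => by
    rw [hgy]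
    exact (contDiffAt_vecInChart hft
      ((he i).1.contMDiffAt_fst Filter.univ_mem)).differentiableAt (by simp)
  have hθ : ∀ i, DifferentiableAt ℝ (covecInChart J (f x) fun q => (e i q).2)
      (mapInChart I J f x y) := fun i => by
    rw [hgy]
    exact (contDiffAt_covecInChart hft
      ((he i).1.contMDiffAt_snd Filter.univ_mem)).differentiableAt (by simp)
  have hls := eventually_lift_inChart hf hU hxU ha
  have hlt := eventually_lift_inChart hf hU hxU hb
  have hiso : ∀ i j, covecInChart J (f x) (fun q => (e i q).2) (mapInChart I J f x y)
        (vecInChart J (f x) (fun q => (e j q).1) (mapInChart I J f x y)) +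
      covecInChart J (f x) (fun q => (e j q).2) (mapInChart I J f x y)
        (vecInChart J (f x) (fun q => (e i q).1) (mapInChart I J f x y)) = 0 := fun i j => by
    rw [hgy]
    simp only [covecInChart_extChartAt hfx, vecInChart_extChartAt hfx,
      ContinuousLinearMap.comp_apply, fromModel_toModel hfx]
    exact (hL.maximal_isotropic (f x)).1 (e j (f x)) ((he j).2 _) (e i (f x)) ((he i).2 _)
  have hbr1 := fderiv_lieBracket_pushforward hg hX hX' (hcoeff a has) (hcoeff b hbs) hY
    (hls.mono fun _ h => h.1) (hlt.mono fun _ h => h.1)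
  have hbr2 := flatBracketForm_pullback hg hX (hcoeff a has) (hcoeff b hbs) hY hθ
    (hls.mono fun _ h => h.1) hlt.self_of_nhds.1 (hls.mono fun _ h => h.2)
    (hlt.mono fun _ h => h.2) hiso
  rw [← toModel_courantBracket_fst, hgy, hg'] at hbr1
  rw [← courantBracket_snd_comp hs ht, hgy, hg'] at hbr2
  simp only [hyx, vecInChart_extChartAt hfx, covecInChart_extChartAt hfx,
    ← toModel_courantBracket_fst, ← courantBracket_snd_comp (he _).1 (he _).1] at hbr1 hbr2
  set α : Fin k → ℝ := fun j => fderiv ℝ (fun z => b j ((extChartAt I x).symm z)) y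
    (vecInChart I x (fun q => (s q).1) y)
  set β : Fin k → ℝ := fun j => fderiv ℝ (fun z => a j ((extChartAt I x).symm z)) y
    (vecInChart I x (fun q => (t q).1) y)
  -- the lift of the bracket to `L`
  set Z : GenTangent J (f x) := ∑ i, ∑ j, (a i x * b j x) • courantBracket J (e i) (e j) (f x)
    + ∑ j, α j • e j (f x) - ∑ i, β i • e i (f x) with hZ
  have hZL : Z ∈ L (f x) := by
    refine (L (f x)).sub_mem ((L (f x)).add_mem ?_ ?_) ?_
    · exact Submodule.sum_mem _ fun i _ => Submodule.sum_mem _ fun j _ =>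
        Submodule.smul_mem _ _ (hL.involutive _ _ (he i) (he j) _)
    · exact Submodule.sum_mem _ fun j _ => Submodule.smul_mem _ _ ((he j).2 _)
    · exact Submodule.sum_mem _ fun j _ => Submodule.smul_mem _ _ ((he j).2 _)
  have h1 : mfderiv I J f x (courantBracket I s t x).1 = Z.1 := by
    rw [← fromModel_toModel hfx (mfderiv I J f x _), ← fromModel_toModel hfx Z.1]
    congr 1
    rw [mfderivInChart, ContinuousLinearMap.comp_apply, ContinuousLinearMap.comp_apply,
      fromModel_toModel hx] at hbr1
    rw [hbr1, hZ]
    simp [Prod.fst_sum, α, β]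
  refine ⟨Z.2, by rw [h1]; exact hZL, ?_⟩
  ext v
  have h2 := DFunLike.congr_fun hbr2 (toModel I x x v)
  simp only [mfderivInChart, ContinuousLinearMap.comp_apply, fromModel_toModel hx] at h2
  rw [h2, hZ]
  simp [Prod.snd_sum, sum_apply, fromModel_toModel hfx, α, β]

/-- The backward image of a Dirac structure is a Dirac structure when `f^! L` is smooth. -/
lemma isDirac_backward [T2Space M] (hf : ContMDiff I J ∞ f) (hL : IsDirac J L)
    (hsmooth : ShriekSmooth I J f L) : IsDirac I (backward I J f L) where
  smooth_subbundle := by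
    refine ⟨Module.finrank ℝ E, fun x => ?_⟩
    obtain ⟨U, hU, hxU, hframe, -⟩ := exists_local_lift hf hL hsmooth x
    exact ⟨U, hU, hxU, hframe⟩
  maximal_isotropic x := maximal_isotropic_backward (hL.maximal_isotropic (f x))
  involutive s t hs ht x := by
    obtain ⟨U, hU, hxU, -, k, e, he, hlift⟩ := exists_local_lift hf hL hsmooth x
    obtain ⟨a, has, ha⟩ := hlift s hs
    obtain ⟨b, hbs, hb⟩ := hlift t ht
    exact courantBracket_mem_backward hf hL hU hxU (fun i => (he i).1) hs.1 ht.1 has hbs ha hb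

/-! ### The foliation of the backward image -/

lemma foliation_backward_subset [T2Space M] [T2Space B] [SecondCountableTopology B]
    (hf : ContMDiff I J ∞ f) (hL : IsDirac J L) (hsmooth : ShriekSmooth I J f L) :
    foliation I (backward I J f L) ⊆ pullbackFoliation I J f (foliation J L) := by
  rintro X ⟨s, hs, hsc, hX⟩
  obtain rfl : X = fun x => (s x).1 := funext hX
  have : LocallyCompactSpace B := Manifold.locallyCompact_of_finiteDimensional I
  set S := closure {x | s x ≠ 0} with hS
  choose U hU hxU _ k e he hlift using exists_local_lift (I := I) hf hL hsmooth
  choose a has ha using fun x => hlift x s hs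
  choose K hK hxK hKU using fun x => exists_compact_subset (hU x) (hxU x)
  obtain ⟨t, ht⟩ := hsc.elim_finite_subcover (fun x => interior (K x))
    (fun x => isOpen_interior) fun x _ => Set.mem_iUnion.2 ⟨x, hxK x⟩
  obtain ⟨ρ, hρ⟩ := SmoothPartitionOfUnity.exists_isSubordinate I (s := S) isClosed_closure
    (fun i : t => interior (K i)) (fun i => isOpen_interior) (by
      intro x hx
      obtain ⟨i, hi, hxi⟩ := Set.mem_iUnion₂.1 (ht hx)
      exact Set.mem_iUnion.2 ⟨⟨i, hi⟩, hxi⟩)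
  have hρK : ∀ i : t, tsupport (ρ i) ⊆ K i := fun i => (hρ i).trans interior_subset
  let N := Σ i : t, Fin (k i)
  let φ := (Fintype.equivFin N).symm
  -- also where the lift is unavailable, since `ρ i` vanishes there
  have hloc : ∀ (i : t) (x : B), ∑ j, (ρ i x * a i j x) • (e i j (f x)).1 =
      ρ i x • mfderiv I J f x (s x).1 := fun i x => by
    by_cases hx : x ∈ tsupport (ρ i)
    · rw [(ha i x (hKU i (hρK i hx))).1, Finset.smul_sum]
      simp only [smul_smul]
    · simp [image_eq_zero_of_notMem_tsupport hx]
  refine ⟨hs.1.1, hsc.of_isClosed_subset isClosed_closure (closure_mono ?_), Fintype.card N,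
    fun m x => ρ (φ m).1 x * a (φ m).1 (φ m).2 x, fun m p => (e (φ m).1 (φ m).2 p).1,
    fun m => ⟨?_, ?_, ?_⟩, fun x => ?_⟩
  · intro x hx h0
    exact hx (by simp [h0])
  · refine contMDiff_of_tsupport fun x hx => ?_
    have hx' : x ∈ tsupport (ρ (φ m).1) := tsupport_mul_subset_left hx
    exact (ρ (φ m).1).contMDiff.contMDiffAt.mul (has _ _ _ (hKU _ (hρK _ hx')))
  · have : HasCompactSupport (ρ (φ m).1) :=
      (hK _).of_isClosed_subset (isClosed_tsupport _) (hρK _)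
    exact this.mul_right
  · exact ⟨e (φ m).1 (φ m).2, (he _ _).1, (he _ _).2, fun p => rfl⟩
  · rw [Equiv.sum_comp φ fun m : N => (ρ m.1 x * a m.1 m.2 x) • (e m.1 m.2 (f x)).1,
      Fintype.sum_sigma]
    simp only [hloc]
    rw [← Finset.sum_smul]
    by_cases hx : x ∈ S
    · have := ρ.sum_eq_one hx
      rw [finsum_eq_sum_of_fintype] at this
      rw [this, one_smul]
    · have : s x = 0 := by
        by_contra h
        exact hx (subset_closure h)
      simp [this]

omit [FiniteDimensional ℝ E] [FiniteDimensional ℝ E'] in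
lemma pullbackFoliation_subset [T2Space B] (hf : ContMDiff I J ∞ f) :
    pullbackFoliation I J f (foliation J L) ⊆ foliation I (backward I J f L) := by
  rintro X ⟨hXs, hXc, n, h, Y, hhY, hX⟩
  choose e he hec heY using fun i => (hhY i).2.2
  refine ⟨fun x => (X x, ∑ i, h i x • (e i (f x)).2.comp (mfderiv I J f x)),
    ⟨⟨hXs, fun x _ => ContMDiffAt.contMDiffWithinAt ?_⟩, fun x => ?_⟩, ?_, fun x => rfl⟩
  · refine (contMDiffAt_form_iff (mem_chart_source H x)).2 ?_
    have hsm : ContMDiffAt I 𝓘(ℝ, E →L[ℝ] ℝ) ∞ (fun r => ∑ i, h i r •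
        ((e i (f r)).2.comp (fromModel J (f x) (f r))).comp (mfderivInChart I J f x r)) x := by
      refine ContMDiffAt.sum fun i _ => ((hhY i).1 x).smul (ContMDiffAt.clm_comp ?_
        (contMDiffAt_mfderivInChart hf x).self_of_nhds)
      exact ((contMDiffAt_form_iff (mem_chart_source H' (f x))).1
        ((he i).1.contMDiffAt_snd Filter.univ_mem)).comp x (hf x)
    refine hsm.congr_of_eventuallyEq ?_
    filter_upwards [eventually_mem_charts hf x] with r hr
    ext v
    simp [sum_apply, mfderivInChart, fromModel_toModel hr.2]
  · refine ⟨∑ i, h i x • (e i (f x)).2, ?_, ?_⟩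
    · have hmem : ∑ i, h i x • e i (f x) ∈ L (f x) :=
        Submodule.sum_mem _ fun i _ => Submodule.smul_mem _ _ ((he i).2 _)
      convert hmem using 1
      refine Prod.ext ?_ ?_
      · simp [Prod.fst_sum, hX x, heY]
      · simp [Prod.snd_sum]
    · ext v
      simp [sum_apply]
  · have hK : IsCompact (closure {x | X x ≠ 0} ∪ ⋃ i, tsupport (h i)) :=
      hXc.union (isCompact_iUnion fun i => (hhY i).2.1)
    refine hK.closure_of_subset fun x hx => ?_
    by_contra hnot
    rw [Set.mem_union, not_or, Set.mem_iUnion, not_exists] at hnot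
    have h1 : X x = 0 := by
      by_contra hne
      exact hnot.1 (subset_closure hne)
    refine hx (Prod.ext h1 ?_)
    change ∑ i, h i x • (e i (f x)).2.comp (mfderiv I J f x) = 0
    exact Finset.sum_eq_zero fun i _ => by
      rw [image_eq_zero_of_notMem_tsupport (hnot.2 i), zero_smul]

end Main
end DiracPullback
end
open DiracPullback in
theorem corollary4p5
    {E : Type*} [NormedAddCommGroup E] [NormedSpace ℝ E] [FiniteDimensional ℝ E]
    {H : Type*} [TopologicalSpace H] (I : ModelWithCorners ℝ E H) [I.Boundaryless]
    {B : Type*} [TopologicalSpace B] [ChartedSpace H B] [IsManifold I ∞ B]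
    [T2Space B] [SecondCountableTopology B]
    {E' : Type*} [NormedAddCommGroup E'] [NormedSpace ℝ E'] [FiniteDimensional ℝ E']
    {H' : Type*} [TopologicalSpace H'] (J : ModelWithCorners ℝ E' H') [J.Boundaryless]
    {M : Type*} [TopologicalSpace M] [ChartedSpace H' M] [IsManifold J ∞ M]
    [T2Space M] [SecondCountableTopology M]
    (f : B → M) (hf : ContMDiff I J ∞ f)
    (L : GenDistribution J M) (hL : IsDirac J L) (hsmooth : ShriekSmooth I J f L) :
    IsDirac I (backward I J f L) ∧
      foliation I (backward I J f L) = pullbackFoliation I J f (foliation J L) := by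
  exact ⟨isDirac_backward hf hL hsmooth,
    (foliation_backward_subset hf hL hsmooth).antisymm (pullbackFoliation_subset hf)⟩
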